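/- Let $k$ be a field with $\operatorname{char} k\neq 2$, let $n\ge 3$ be odd, $m=(n-1)/2$, and let $R=k[x_1,\dots,x_n]$ be graded by $\deg x_l=d_l$ for positive integers $d_l$; put $d=\sum_{l=1}^n d_l$. Let $M$ be a ($\mathbb Z$-)graded $R$-module of finite length, $s\in\mathbb Z$ and $\varepsilon\in\{1,-1\}$, and suppose that $M$ is Gorenstein with shift $s$ and sign $\varepsilon$: there is a graded isomorphism of $R$-modules $\tau:M\to \operatorname{Hom}_k(M,k)(-s)$ such that $\operatorname{Hom}_k(\tau,k)(-s)=\varepsilon\tau$ under the canonical identification $M\cong M^{**}$, i.e. $\tau(x)(y)=\varepsilon\,\tau(y)(x)$ for all $x,y\in M$. If $M\neq 0$, then $s$ is the sum of the lowest and the highest degree in which $M$ is nonzero; in particular $s$ is the top degree of $M$ if the lowest degree of $M$ is $0$. Moreover, writing $(\ )^\vee=\operatorname{Hom}_R(\ ,R(-d-s))$, the module $M$ has a minimal graded free resolution of the form $$0\leftarrow M\leftarrow F_0\xleftarrow{\psi_1}F_1\leftarrow\cdots\leftarrow F_m\xleftarrow{\psi_{m+1}}F_m^\vee\xleftarrow{\psi_m^\vee}\cdots\leftarrow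 F_1^\vee\xleftarrow{\psi_1^\vee}F_0^\vee\leftarrow 0$$ with finitely generated graded free modules $F_i$, such that for every basis $B$ of $F_m$ with dual basis $B^\vee$ of $F_m^\vee$ the matrix $A$ of $\psi_{m+1}$ with respect to $B^\vee$ and $B$ satisfies $A^t=(-1)^m\varepsilon A$. In particular, if $\varepsilon=1$, then $\psi_{m+1}$ is skew if $m$ is odd and symmetric if $m$ is even. -/

import Mathlib

open MvPolynomial

namespace GorensteinFiniteLength

/-- A map is homogeneous of degree `0` if it maps the `j`-th graded piece into the `j`-th graded
piece, for all `j`. -/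
def IsHomogeneousMap {k A B : Type*} [Semiring k] [AddCommMonoid A] [Module k A]
    [AddCommMonoid B] [Module k B] (𝓐 : ℤ → Submodule k A) (𝓑 : ℤ → Submodule k B)
    (f : A → B) : Prop :=
  ∀ (j : ℤ) (x : A), x ∈ 𝓐 j → f x ∈ 𝓑 j

section VectorSpaceDual

variable {k M : Type*} [Field k] [AddCommGroup M] [Module k M]

/-- The grading of the twisted vector space dual `Hom_k(M, k)(a)`, where `k` sits in degree `0`:
a functional of degree `j` maps `M_i` into `k_{i + j + a}`, hence vanishes on `M_i` unless
`i + j + a = 0`. -/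
def vectorDualGrading (𝓜 : ℤ → Submodule k M) (a : ℤ) (j : ℤ) :
    Submodule k (Module.Dual k M) where
  carrier := {φ | ∀ i : ℤ, i + j + a ≠ 0 → ∀ x ∈ 𝓜 i, φ x = 0}
  zero_mem' := fun _ _ _ _ => rfl
  add_mem' := by
    intro φ χ hφ hχ i hi x hx
    rw [LinearMap.add_apply, hφ i hi x hx, hχ i hi x hx, add_zero]
  smul_mem' := by
    intro c φ hφ i hi x hx
    rw [LinearMap.smul_apply, hφ i hi x hx, smul_zero]

/-- The graded module `M` over the ring `R` is Gorenstein with sign `ε` and shift `s`: there is a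
graded isomorphism of `R`-modules `τ : M → Hom_k(M, k)(-s)` with `τ^*(-s) = ε τ`.
Here `R` acts on `Hom_k(M, k)` by `(r φ)(y) = φ(r y)`, and `τ^*(-s)` is regarded as a map on `M`
through the canonical map `M → M^{**}`. -/
def IsGorenstein (R : Type*) [CommRing R] [Module R M] (𝓜 : ℤ → Submodule k M)
    (ε : ℤˣ) (s : ℤ) : Prop :=
  ∃ τ : M ≃ₗ[k] Module.Dual k M,
    (∀ (r : R) (x y : M), τ (r • x) y = τ x (r • y)) ∧
    IsHomogeneousMap 𝓜 (vectorDualGrading 𝓜 (-s)) τ ∧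
    τ.toLinearMap.dualMap ∘ₗ Module.Dual.eval k M = (ε : ℤ) • τ.toLinearMap

end VectorSpaceDual

section Resolution

variable {k : Type*} [Field k] {n : ℕ} (d : Fin n → ℤ)

/-- The grading of the free module `⨁_i R(-e_i)`, whose `i`-th standard basis vector has
degree `e_i`, over the weighted polynomial ring `R = k[x_1, …, x_n]` with `deg x_l = d_l`. -/
def freeGrading {ι : Type*} (e : ι → ℤ) (j : ℤ) : Submodule k (ι → MvPolynomial (Fin n) k) where
  carrier := {v | ∀ i, v i ∈ weightedHomogeneousSubmodule k d (j - e i)}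
  zero_mem' := fun _ => Submodule.zero_mem _
  add_mem' := fun hv hw i => Submodule.add_mem _ (hv i) (hw i)
  smul_mem' := fun c _ hv i => Submodule.smul_mem _ c (hv i)

/-- The grading of `Hom_R(F, R(a))` for a graded module `F`: a functional of degree `j` maps `F_i`
into `R(a)_{i + j} = R_{i + j + a}`. -/
def ringDualGrading {F : Type*} [AddCommGroup F] [Module k F] [Module (MvPolynomial (Fin n) k) F]
    (𝓕 : ℤ → Submodule k F) (a : ℤ) (j : ℤ) :
    Submodule k (Module.Dual (MvPolynomial (Fin n) k) F) where
  carrier := {φ | ∀ i : ℤ, ∀ x ∈ 𝓕 i, φ x ∈ weightedHomogeneousSubmodule k d (i + j + a)}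
  zero_mem' := fun _ _ _ => Submodule.zero_mem _
  add_mem' := fun hφ hχ i x hx => Submodule.add_mem _ (hφ i x hx) (hχ i x hx)
  smul_mem' := fun c _ hφ i x hx => Submodule.smul_mem _ c (hφ i x hx)

/-- The image of the map lies in `𝔪 G`, where `𝔪 = (x_1, …, x_n)`. -/
def IsMinimalMap {F G : Type*} [AddCommGroup F] [Module (MvPolynomial (Fin n) k) F]
    [AddCommGroup G] [Module (MvPolynomial (Fin n) k) G]
    (f : F →ₗ[MvPolynomial (Fin n) k] G) : Prop :=
  LinearMap.range f ≤
    Ideal.span (Set.range (X : Fin n → MvPolynomial (Fin n) k)) •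
      (⊤ : Submodule (MvPolynomial (Fin n) k) G)

/-- A graded free resolution of the graded module `M` of the selfdual form
`0 ← M ← F_0 ← F_1 ← ⋯ ← F_m ← F_m^∨ ← ⋯ ← F_1^∨ ← F_0^∨ ← 0` for an integer `m ≥ 1`, where
`F_i = ⨁_j R(-deg i j)` has finite rank and `(-)^∨ = Hom_R(-, R(-(d_1 + ⋯ + d_n) - s))`.

The maps are the augmentation `aug : F_0 → M`, the maps `ψ i : F_i → F_{i-1}` for `1 ≤ i ≤ m`, the
middle map `mid : F_m^∨ → F_m`, and the duals `(ψ i)^∨ : F_{i-1}^∨ → F_i^∨` (which are homogeneous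
because the `ψ i` are). Only the `F_i` with `i ≤ m` and the `ψ i` with `1 ≤ i ≤ m` occur in
the resolution; the other values of `rank`, `deg`, `ψ` carry no meaning. -/
structure SelfdualResolution {M : Type*} [AddCommGroup M] [Module k M]
    [Module (MvPolynomial (Fin n) k) M] (𝓜 : ℤ → Submodule k M) (m : ℕ) (s : ℤ) where
  rank : ℕ → ℕ
  deg : ∀ i : ℕ, Fin (rank i) → ℤ
  aug : (Fin (rank 0) → MvPolynomial (Fin n) k) →ₗ[MvPolynomial (Fin n) k] M
  ψ : ∀ i : ℕ, (Fin (rank i) → MvPolynomial (Fin n) k) →ₗ[MvPolynomial (Fin n) k]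
    (Fin (rank (i - 1)) → MvPolynomial (Fin n) k)
  mid : Module.Dual (MvPolynomial (Fin n) k) (Fin (rank m) → MvPolynomial (Fin n) k)
    →ₗ[MvPolynomial (Fin n) k] (Fin (rank m) → MvPolynomial (Fin n) k)
  aug_homogeneous : IsHomogeneousMap (freeGrading d (deg 0)) 𝓜 aug
  ψ_homogeneous : ∀ i, 1 ≤ i → i ≤ m →
    IsHomogeneousMap (freeGrading (k := k) d (deg i)) (freeGrading d (deg (i - 1))) (ψ i)
  mid_homogeneous : IsHomogeneousMap
    (ringDualGrading d (freeGrading (k := k) d (deg m)) (-(∑ l, d l) - s))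
    (freeGrading d (deg m)) mid
  aug_surjective : Function.Surjective aug
  exact_zero : Function.Exact (ψ 1) aug
  exact_left : ∀ i, 1 ≤ i → i < m → Function.Exact (ψ (i + 1)) (ψ i)
  exact_mid : Function.Exact mid (ψ m)
  exact_mid_dual : Function.Exact (ψ m).dualMap mid
  exact_right : ∀ i, 1 ≤ i → i < m → Function.Exact (ψ i).dualMap (ψ (i + 1)).dualMap
  injective_last : Function.Injective (ψ 1).dualMap

/-- The resolution is minimal: every map between its free modules has image in `𝔪` times its
target. -/
def SelfdualResolution.IsMinimal {d : Fin n → ℤ} {M : Type*} [AddCommGroup M] [Module k M]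
    [Module (MvPolynomial (Fin n) k) M] {𝓜 : ℤ → Submodule k M} {m : ℕ} {s : ℤ}
    (F : SelfdualResolution d 𝓜 m s) : Prop :=
  (∀ i, 1 ≤ i → i ≤ m → IsMinimalMap (F.ψ i)) ∧ IsMinimalMap F.mid ∧
    (∀ i, 1 ≤ i → i ≤ m → IsMinimalMap (F.ψ i).dualMap)

end Resolution

end GorensteinFiniteLength

/-! The Koszul complex of the commuting operators $x_l\otimes 1-1\otimes x_l$ on $R\otimes_k M$ is a
free resolution of $M$ of length $n$. It is rarely minimal, but it is visibly selfdual. The form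
$\tau$ makes multiplication by each $x_l$ selfadjoint on $M$, and a wedge pairing with adjusted
signs (`koszulForm`) makes each contraction selfadjoint on the exterior algebra. The product of the
two is a constant nondegenerate form $J$ with $D^tJ=JD$ for the total differential $D$. Moreover
$J^t=(-1)^m\varepsilon J$, because $0+1+\dots+(n-1)=m(2m+1)\equiv m$ modulo $2$.

The difficulty is to make the resolution minimal without losing this symmetry. The constant part $x$
of $D$ is a selfadjoint differential over $k$. As $2$ is invertible, it has a selfadjoint
contraction $h$ with $h^2=0$ (`exists_selfadjoint_contraction`), so $e=1-xh-hx$ is a selfadjoint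
projection onto a copy of the homology of $x$, to which $J$ restricts nondegenerately. Homological
perturbation (`perturbation_identities`, `exists_minimalReduction`) transfers $D$ to a homotopy
equivalent differential $D_1$ on the image of $e$, extended to $R$. All constant terms of $D_1$
vanish, and since the perturbed homotopy is again selfadjoint, the transferred form is still
constant and $D_1$ is selfadjoint for it.

With $K$ the inverse of the transferred form, $D_1K$ is symmetric up to the sign
$(-1)^m\varepsilon$. The blocks of $D_1$ in homological degrees at most $m$ give the left half of
the resolution, the middle block of $D_1K$ gives the middle map, and the transposed blocks give the
right half. The right half is exact because $K$ carries $D_1^t$ to $D_1$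
(`exists_selfdualResolution`).

Both gradings are carried by one weight with values in $\mathbb Z\times\mathbb Z$, the homological
and the internal degree. -/

namespace GorensteinFiniteLength

open Matrix

/-! ### Homogeneous matrices over a field and their generalized inverses -/

section ConstantMatrices

variable {k Γ α β κ : Type*} [Field k] [AddCommGroup Γ]

/-- The matrix `A` describes a map of degree `c` between vector spaces with homogeneous bases,
whose elements have degrees `γ b` (source) and `γ' a` (target). -/
def IsHomogConst (γ' : α → Γ) (γ : β → Γ) (c : Γ) (A : Matrix α β k) : Prop :=
  ∀ a b, A a b ≠ 0 → γ b + c = γ' a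

open Classical in
/-- The component of degree `c` of a matrix between graded vector spaces. -/
noncomputable def homogComponent (γ' : α → Γ) (γ : β → Γ) (c : Γ) (A : Matrix α β k) :
    Matrix α β k :=
  Matrix.of fun a b => if γ b + c = γ' a then A a b else 0

variable {γ₁ : α → Γ} {γ₂ : β → Γ} {γ₃ : κ → Γ} {c c' : Γ}

lemma isHomogConst_homogComponent (A : Matrix α β k) :
    IsHomogConst γ₁ γ₂ c (homogComponent γ₁ γ₂ c A) := by
  intro a b h
  by_contra hne
  exact h (by simp [homogComponent, hne])

lemma IsHomogConst.homogComponent_eq {A : Matrix α β k} (hA : IsHomogConst γ₁ γ₂ c A) :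
    homogComponent γ₁ γ₂ c A = A := by
  ext a b
  by_cases h : γ₂ b + c = γ₁ a
  · simp [homogComponent, h]
  · have : A a b = 0 := by
      by_contra h0
      exact h (hA a b h0)
    simp [homogComponent, h, this]

lemma ite_zero_sum {β R : Type*} [Fintype β] [AddCommMonoid R] (C : Prop) [Decidable C]
    (f : β → R) : (∑ x, if C then f x else 0) = if C then ∑ x, f x else 0 := by
  split_ifs <;> simp

/-- A homogeneous factor shifts all degrees by the same amount, so taking components commutes with
multiplying by it. This allows solutions of homogeneous matrix equations to be replaced by
homogeneous ones. -/
lemma IsHomogConst.mul_homogComponent [Fintype β] {A : Matrix α β k}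
    (hA : IsHomogConst γ₁ γ₂ c A) (B : Matrix β κ k) :
    A * homogComponent γ₂ γ₃ c' B = homogComponent γ₁ γ₃ (c' + c) (A * B) := by
  ext a b
  simp only [homogComponent, Matrix.mul_apply, Matrix.of_apply]
  rw [← ite_zero_sum]
  refine Finset.sum_congr rfl fun x _ => ?_
  by_cases h : A a x = 0
  · simp [h]
  · have h1 := hA a x h
    have : γ₃ b + c' = γ₂ x ↔ γ₃ b + (c' + c) = γ₁ a := by
      rw [← h1, ← add_assoc, add_left_inj]
    by_cases h2 : γ₃ b + (c' + c) = γ₁ a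
    · rw [if_pos (this.mpr h2), if_pos h2]
    · rw [if_neg (mt this.mp h2), if_neg h2]; simp

lemma IsHomogConst.homogComponent_mul [Fintype β] {B : Matrix β κ k}
    (hB : IsHomogConst γ₂ γ₃ c' B) (A : Matrix α β k) :
    homogComponent γ₁ γ₂ c A * B = homogComponent γ₁ γ₃ (c' + c) (A * B) := by
  ext a b
  simp only [homogComponent, Matrix.mul_apply, Matrix.of_apply]
  rw [← ite_zero_sum]
  refine Finset.sum_congr rfl fun x _ => ?_
  by_cases h : B x b = 0
  · simp [h]
  · have h1 := hB x b h
    have : γ₂ x + c = γ₁ a ↔ γ₃ b + (c' + c) = γ₁ a := by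
      rw [← h1, ← add_assoc]
    by_cases h2 : γ₃ b + (c' + c) = γ₁ a
    · rw [if_pos (this.mpr h2), if_pos h2]
    · rw [if_neg (mt this.mp h2), if_neg h2]; simp

lemma IsHomogConst.mul [Fintype β] {A : Matrix α β k} {B : Matrix β κ k}
    (hA : IsHomogConst γ₁ γ₂ c A) (hB : IsHomogConst γ₂ γ₃ c' B) :
    IsHomogConst γ₁ γ₃ (c' + c) (A * B) := by
  rw [← hB.homogComponent_eq, hA.mul_homogComponent]
  exact isHomogConst_homogComponent _

lemma IsHomogConst.sub {A B : Matrix α β k}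
    (hA : IsHomogConst γ₁ γ₂ c A) (hB : IsHomogConst γ₁ γ₂ c B) :
    IsHomogConst γ₁ γ₂ c (A - B) := by
  intro a b h
  by_cases h0 : A a b = 0
  · exact hB a b fun h1 => h (by simp [h0, h1])
  · exact hA a b h0

lemma IsHomogConst.smul {A : Matrix α β k} (hA : IsHomogConst γ₁ γ₂ c A) (r : k) :
    IsHomogConst γ₁ γ₂ c (r • A) :=
  fun a b h => hA a b fun h1 => h (by simp [h1])

lemma isHomogConst_one [DecidableEq α] : IsHomogConst γ₁ γ₁ 0 (1 : Matrix α α k) := by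
  intro a b h
  have : a = b := by
    by_contra hne
    exact h (Matrix.one_apply_ne hne)
  simp [this]

lemma IsHomogConst.transpose {A : Matrix α β k} (hA : IsHomogConst γ₁ γ₂ c A) (g : Γ) :
    IsHomogConst (fun b => g - γ₂ b) (fun a => g - γ₁ a) c Aᵀ := by
  intro b a h
  simp only [← hA a b h]
  abel

/-- Homogeneous matrices over a field have homogeneous generalized inverses. -/
lemma IsHomogConst.exists_generalizedInverse [Fintype α] [Fintype β] [DecidableEq α]
    [DecidableEq β] {A : Matrix α β k} (hA : IsHomogConst γ₁ γ₂ c A) :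
    ∃ G : Matrix β α k, IsHomogConst γ₂ γ₁ (-c) G ∧ A * G * A = A := by
  let f := Matrix.toLin' A
  obtain ⟨r, hr⟩ := f.rangeRestrict.exists_rightInverse_of_surjective f.range_rangeRestrict
  obtain ⟨g, hg⟩ := LinearMap.exists_extend r
  have hfg : f ∘ₗ g ∘ₗ f = f := by
    ext1 x
    ext1
    have h1 : g (f (Pi.single x 1)) = r ⟨f (Pi.single x 1), LinearMap.mem_range_self _ _⟩ :=
      LinearMap.congr_fun hg ⟨f (Pi.single x 1), LinearMap.mem_range_self _ _⟩
    have h2 := LinearMap.congr_fun hr ⟨f (Pi.single x 1), LinearMap.mem_range_self _ _⟩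
    have h3 := congrArg Subtype.val h2
    simp only [LinearMap.comp_apply, LinearMap.codRestrict_apply, LinearMap.id_apply,
      LinearMap.coe_single] at h3 ⊢
    rw [h1]
    exact h3
  have hG : A * LinearMap.toMatrix' g * A = A := by
    have := congrArg LinearMap.toMatrix' hfg
    rwa [LinearMap.toMatrix'_comp, LinearMap.toMatrix'_comp, LinearMap.toMatrix'_toLin',
      ← Matrix.mul_assoc] at this
  -- Any generalized inverse will do: in degree `c`, only its component of degree `-c` contributes
  -- to the equation `A * G * A = A`.
  refine ⟨homogComponent γ₂ γ₁ (-c) (LinearMap.toMatrix' g), isHomogConst_homogComponent _, ?_⟩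
  rw [hA.mul_homogComponent, hA.homogComponent_mul, hG, neg_add_cancel, add_zero,
    hA.homogComponent_eq]

end ConstantMatrices

/-! ### Selfadjoint contractions of a differential over a field -/

section Contraction

/-- A generalized inverse `g` of a differential `x` can be modified so that it becomes a
differential, in a way that respects all anti-involutions exchanging `x * g` and `g * x`. -/
lemma contraction_identities {k A : Type*} [Field k] [Ring A] [Algebra k A] (h2 : (2 : k) ≠ 0)
    {x g h : A} (hxx : x * x = 0) (hxg : x * g * x = x) (hgx : g * x * g = g)
    (hh : h = (1 - (1 / 2 : k) • (x * g)) * g * (1 - (1 / 2 : k) • (g * x))) :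
    h * h = 0 ∧ x * h * x = x ∧ h * x * h = h := by
  have e1 : ∀ y, g * (x * (g * y)) = g * y := fun y => by rw [← mul_assoc, ← mul_assoc, hgx]
  have e2 : g * (x * g) = g := by rw [← mul_assoc, hgx]
  have e3 : x * (g * x) = x := by rw [← mul_assoc, hxg]
  have e4 : ∀ y, x * (x * y) = 0 := fun y => by rw [← mul_assoc, hxx, zero_mul]
  have e5 : ∀ y, x * (g * (x * y)) = x * y := fun y => by
    rw [← mul_assoc, ← mul_assoc, hxg]
  have half : ∀ y : A, y - (1 / 2 : k) • y - (1 / 2 : k) • y = 0 := fun y => by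
    have : ((1 : k) - 1 / 2 - 1 / 2) • y = 0 := by
      rw [show (1 : k) - 1 / 2 - 1 / 2 = 0 by field_simp; norm_num, zero_smul]
    simpa only [sub_smul, one_smul] using this
  -- The two halves each remove one half of `g * g`. The one-sided correction `(1 - x * g) * g`
  -- would also square to zero, without dividing by 2, but it is not symmetric under
  -- anti-involutions fixing `x` and `g`.
  have key : g * (1 - (1 / 2 : k) • (g * x)) * (1 - (1 / 2 : k) • (x * g)) * g = 0 := by
    have := half (g * g)
    simp only [mul_sub, sub_mul, mul_one, smul_mul_assoc, mul_smul_comm, mul_assoc, e2, e4,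
      smul_zero, mul_zero, sub_zero]
    rw [← this]
  have left : x * (1 - (1 / 2 : k) • (x * g)) = x := by
    rw [mul_sub, mul_smul_comm, e4, smul_zero, mul_one, sub_zero]
  have right : (1 - (1 / 2 : k) • (g * x)) * x = x := by
    rw [sub_mul, smul_mul_assoc, mul_assoc, hxx, mul_zero, smul_zero, one_mul, sub_zero]
  refine ⟨?_, ?_, ?_⟩
  · calc h * h = (1 - (1 / 2 : k) • (x * g)) *
          (g * (1 - (1 / 2 : k) • (g * x)) * (1 - (1 / 2 : k) • (x * g)) * g) *
          (1 - (1 / 2 : k) • (g * x)) := by rw [hh]; simp only [mul_assoc]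
      _ = 0 := by rw [key]; simp
  · calc x * h * x = (x * (1 - (1 / 2 : k) • (x * g))) * g * ((1 - (1 / 2 : k) • (g * x)) * x) := by
          rw [hh]; simp only [mul_assoc]
      _ = x := by rw [left, right, hxg]
  · calc h * x * h = (1 - (1 / 2 : k) • (x * g)) * (g * (((1 - (1 / 2 : k) • (g * x)) * x) *
          (1 - (1 / 2 : k) • (x * g))) * g) * (1 - (1 / 2 : k) • (g * x)) := by
          rw [hh]; simp only [mul_assoc]
      _ = h := by rw [right, left, hgx, hh]

variable {k Γ ι : Type*} [Field k] [AddCommGroup Γ] [Fintype ι] [DecidableEq ι]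

lemma transpose_eq_smul_of_mul_eq_one {J J' : Matrix ι ι k} {σ : ℤ} (hJJ' : J * J' = 1)
    (hσ : σ * σ = 1) (hJt : Jᵀ = σ • J) : J'ᵀ = σ • J' := by
  have h1 : J'ᵀ * Jᵀ = 1 := by rw [← transpose_mul, hJJ', transpose_one]
  rw [hJt, Matrix.mul_smul] at h1
  calc J'ᵀ = (J'ᵀ * J) * J' := by rw [Matrix.mul_assoc, hJJ', Matrix.mul_one]
    _ = σ • (σ • (J'ᵀ * J) * J') := by
      rw [Matrix.smul_mul, smul_smul, hσ, one_smul]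
    _ = σ • J' := by rw [h1, Matrix.one_mul]

/-- The component of degree 0 of the inverse is again an inverse, hence equal to it. -/
lemma IsHomogConst.of_mul_eq_one {γ γ' : ι → Γ} {J J' : Matrix ι ι k}
    (hJ : IsHomogConst γ' γ 0 J) (hJJ' : J * J' = 1) : IsHomogConst γ γ' 0 J' := by
  have h1 : J * homogComponent γ γ' 0 J' = 1 := by
    rw [hJ.mul_homogComponent, hJJ', add_zero, isHomogConst_one.homogComponent_eq]
  have h2 : homogComponent γ γ' 0 J' = J' := by
    rw [← Matrix.one_mul (homogComponent γ γ' 0 J'), ← mul_eq_one_comm.mp hJJ', Matrix.mul_assoc,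
      h1, Matrix.mul_one]
  rw [← h2]
  exact isHomogConst_homogComponent _

/-- A homogeneous differential that is selfadjoint with respect to a nondegenerate (skew)
symmetric form has a homogeneous selfadjoint contraction. -/
lemma exists_selfadjoint_contraction (h2 : (2 : k) ≠ 0) {γ : ι → Γ} {ω g₀ : Γ}
    {x J J' : Matrix ι ι k} {σ : ℤ} (hx : IsHomogConst γ γ (-ω) x) (hxx : x * x = 0)
    (hJJ' : J * J' = 1) (hJ : IsHomogConst (fun a => g₀ - γ a) γ 0 J)
    (hxJ : xᵀ * J = J * x) (hσ : σ * σ = 1) (hJt : Jᵀ = σ • J) :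
    ∃ h : Matrix ι ι k, IsHomogConst γ γ ω h ∧ h * h = 0 ∧ x * h * x = x ∧ h * x * h = h ∧
      hᵀ * J = J * h := by
  have hJ'J : J' * J = 1 := mul_eq_one_comm.mp hJJ'
  have hJ' := hJ.of_mul_eq_one hJJ'
  have hJ't := transpose_eq_smul_of_mul_eq_one hJJ' hσ hJt
  obtain ⟨g, hg, hxg⟩ := hx.exists_generalizedInverse
  rw [neg_neg] at hg
  -- The adjoint of `g` with respect to the form `J`; it is a generalized inverse of the selfadjoint
  -- `x` as well.
  set g' := J' * gᵀ * J with hg'_def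
  have hg' : IsHomogConst γ γ ω g' := by
    simpa using (hJ'.mul (hg.transpose g₀)).mul hJ
  have hxJ' : x * J' = J' * xᵀ := by
    calc x * J' = (J' * J) * x * J' := by rw [hJ'J, Matrix.one_mul]
      _ = J' * (J * x) * J' := by simp only [Matrix.mul_assoc]
      _ = J' * xᵀ := by rw [← hxJ]; simp only [Matrix.mul_assoc, hJJ', Matrix.mul_one]
  have hxg' : x * g' * x = x := by
    calc x * g' * x = x * J' * gᵀ * (J * x) := by rw [hg'_def]; simp only [Matrix.mul_assoc]
      _ = J' * (x * g * x)ᵀ * J := by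
        rw [hxJ', ← hxJ]; simp only [Matrix.mul_assoc, transpose_mul]
      _ = x := by rw [hxg, Matrix.mul_assoc, hxJ, ← Matrix.mul_assoc, hJ'J, Matrix.one_mul]
  -- Sandwiching `x` between `g` and its adjoint gives a selfadjoint generalized inverse that also
  -- satisfies `f * x * f = f`. Taking the adjoint twice is the identity because `J` is symmetric or
  -- skew.
  set f := g' * x * g with hf_def
  have hf : IsHomogConst γ γ ω f := by simpa using (hg'.mul hx).mul hg
  have hxf : x * f * x = x := by
    calc x * f * x = (x * g' * x) * g * x := by rw [hf_def]; simp only [Matrix.mul_assoc]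
      _ = x := by rw [hxg', hxg]
  have hfx : f * x * f = f := by
    calc f * x * f = g' * ((x * g * x) * g' * x) * g := by
          rw [hf_def]; simp only [Matrix.mul_assoc]
      _ = f := by rw [hxg, hxg']
  have hfJ : fᵀ * J = J * f := by
    have h1 : g'ᵀ * J = J * g := by
      rw [hg'_def]
      simp only [transpose_mul, transpose_transpose, hJt, hJ't, Matrix.smul_mul,
        Matrix.mul_smul, smul_smul, hσ, one_smul, Matrix.mul_assoc, hJ'J, Matrix.mul_one]
    have h2 : gᵀ * J = J * g' := by
      rw [hg'_def, ← Matrix.mul_assoc, ← Matrix.mul_assoc, hJJ', Matrix.one_mul]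
    calc fᵀ * J = gᵀ * (xᵀ * (g'ᵀ * J)) := by
          rw [hf_def]; simp only [transpose_mul, Matrix.mul_assoc]
      _ = J * f := by
        rw [h1, ← Matrix.mul_assoc xᵀ, hxJ, Matrix.mul_assoc, ← Matrix.mul_assoc gᵀ, h2, hf_def]
        simp only [Matrix.mul_assoc]
  obtain ⟨e1, e2, e3⟩ := contraction_identities h2 hxx hxf hfx rfl
  refine ⟨_, ?_, e1, e2, e3, ?_⟩
  · have h3 : IsHomogConst γ γ 0 (1 - (1 / 2 : k) • (x * f)) :=
      isHomogConst_one.sub (by simpa using (hx.mul hf).smul (1 / 2 : k))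
    have h4 : IsHomogConst γ γ 0 (1 - (1 / 2 : k) • (f * x)) :=
      isHomogConst_one.sub (by simpa using (hf.mul hx).smul (1 / 2 : k))
    simpa using (h3.mul hf).mul h4
  · have h3 : (1 - (1 / 2 : k) • (x * f))ᵀ * J = J * (1 - (1 / 2 : k) • (f * x)) := by
      rw [transpose_sub, transpose_smul, transpose_mul, transpose_one, Matrix.sub_mul,
        Matrix.mul_sub, Matrix.smul_mul, Matrix.mul_smul, Matrix.mul_assoc, hxJ,
        ← Matrix.mul_assoc, hfJ, Matrix.mul_assoc, Matrix.one_mul, Matrix.mul_one]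
    have h4 : (1 - (1 / 2 : k) • (f * x))ᵀ * J = J * (1 - (1 / 2 : k) • (x * f)) := by
      rw [transpose_sub, transpose_smul, transpose_mul, transpose_one, Matrix.sub_mul,
        Matrix.mul_sub, Matrix.smul_mul, Matrix.mul_smul, Matrix.mul_assoc, hfJ,
        ← Matrix.mul_assoc, hxJ, Matrix.mul_assoc, Matrix.one_mul, Matrix.mul_one]
    generalize 1 - (1 / 2 : k) • (x * f) = a at h3 h4
    generalize 1 - (1 / 2 : k) • (f * x) = b at h3 h4
    rw [transpose_mul, transpose_mul, Matrix.mul_assoc, Matrix.mul_assoc, h3, ← Matrix.mul_assoc fᵀ,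
      hfJ, Matrix.mul_assoc, ← Matrix.mul_assoc _ J, h4]
    simp only [Matrix.mul_assoc]

end Contraction

/-! ### Splitting homogeneous idempotents -/

section Idempotent

variable {k Γ ι : Type*} [Field k] [AddCommGroup Γ] [Fintype ι] [DecidableEq ι]

/-- A homogeneous idempotent matrix is the projection to a subspace with a homogeneous basis. -/
lemma IsHomogConst.exists_splitting {γ : ι → Γ} {e : Matrix ι ι k} (he : IsHomogConst γ γ 0 e)
    (hee : e * e = e) :
    ∃ (s : Finset ι) (i : Matrix ι s k) (p : Matrix s ι k),
      IsHomogConst γ (fun a : s => γ a) 0 i ∧ IsHomogConst (fun a : s => γ a) γ 0 p ∧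
      p * i = 1 ∧ i * p = e := by
  classical
  -- A basis of the image is chosen among the columns of `e`, so that it is indexed by a subset of
  -- `ι` and inherits its degrees.
  obtain ⟨t, -, -, hspan, hli⟩ := exists_linearIndepOn_extension (K := k) (v := e.col)
    (s := ∅) (t := Set.univ) (linearIndepOn_empty k _) (Set.empty_subset _)
  let s : Finset ι := t.toFinset
  have hli' : LinearIndependent k fun a : s => e.col a := by
    have := hli.comp (fun a : s => (⟨a, Set.mem_toFinset.mp a.2⟩ : t))
      (fun a b h => Subtype.ext (congrArg (fun x : t => (x : ι)) h))
    exact this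
  have hspan' : ∀ b, ∃ f : s → k, ∑ a, f a • e.col a = e.col b := by
    intro b
    rw [← Submodule.mem_span_range_iff_exists_fun]
    refine Submodule.span_mono ?_ (hspan ⟨b, Set.mem_univ b, rfl⟩)
    rintro _ ⟨a, ha, rfl⟩
    exact ⟨⟨a, Set.mem_toFinset.mpr ha⟩, rfl⟩
  choose f hf using hspan'
  let i : Matrix ι s k := Matrix.of fun a b => e a b
  have hi : IsHomogConst γ (fun a : s => γ a) 0 i := fun a b h => he a b h
  have hif : i * (Matrix.of fun a b => f b a) = e := by
    ext a b
    have := congrFun (hf b) a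
    simp only [Finset.sum_apply, Pi.smul_apply, Matrix.col_apply, smul_eq_mul] at this
    rw [Matrix.mul_apply, ← this]
    exact Finset.sum_congr rfl fun x _ => mul_comm _ _
  let p := homogComponent (fun a : s => γ a) γ 0 (Matrix.of fun a b => f b a)
  have hip : i * p = e := by
    rw [hi.mul_homogComponent, hif, add_zero, he.homogComponent_eq]
  have hei : e * i = i := by
    ext a b
    exact congrFun (congrFun hee a) b
  refine ⟨s, i, p, hi, isHomogConst_homogComponent _, ?_, hip⟩
  have hinj : Function.Injective i.mulVec := Matrix.mulVec_injective_iff.mpr hli'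
  refine Matrix.ext_of_mulVec_single fun a => hinj ?_
  rw [Matrix.mulVec_mulVec, Matrix.mulVec_mulVec, ← Matrix.mul_assoc, hip, hei, Matrix.mul_one]

end Idempotent
-- Homogeneous matrices over a weighted polynomial ring
section HomogeneousMatrices

variable {k Γ τ α β κ : Type*} [Field k] [AddCommGroup Γ]

/-- The matrix `A` over a weighted polynomial ring describes a map of degree `c` between free
modules with homogeneous bases, whose elements have degrees `γ b` (source) and `γ' a` (target). -/
def IsHomog (w : τ → Γ) (γ' : α → Γ) (γ : β → Γ) (c : Γ) (A : Matrix α β (MvPolynomial τ k)) :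
    Prop :=
  ∀ a b, IsWeightedHomogeneous w (A a b) (γ b + c - γ' a)

variable {w : τ → Γ} {γ₁ : α → Γ} {γ₂ : β → Γ} {γ₃ : κ → Γ} {c c' : Γ}

lemma IsHomog.mul [Fintype β] {A : Matrix α β (MvPolynomial τ k)}
    {B : Matrix β κ (MvPolynomial τ k)} (hA : IsHomog w γ₁ γ₂ c A) (hB : IsHomog w γ₂ γ₃ c' B) :
    IsHomog w γ₁ γ₃ (c' + c) (A * B) := by
  intro a b
  rw [Matrix.mul_apply]
  refine IsWeightedHomogeneous.sum _ _ _ fun x _ => ?_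
  convert (hA a x).mul (hB x b) using 1
  abel

lemma IsHomog.sub {A B : Matrix α β (MvPolynomial τ k)} (hA : IsHomog w γ₁ γ₂ c A)
    (hB : IsHomog w γ₁ γ₂ c B) : IsHomog w γ₁ γ₂ c (A - B) :=
  fun a b => (hA a b).sub (hB a b)

lemma IsHomogConst.map {A : Matrix α β k} (hA : IsHomogConst γ₁ γ₂ c A) :
    IsHomog w γ₁ γ₂ c (A.map (C : k →+* MvPolynomial τ k)) := by
  intro a b
  by_cases h : A a b = 0
  · simp [h, isWeightedHomogeneous_zero]
  · rw [hA a b h, sub_self]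
    exact isWeightedHomogeneous_C _ _

lemma IsHomog.map_constantCoeff {A : Matrix α β (MvPolynomial τ k)} (hA : IsHomog w γ₁ γ₂ c A) :
    IsHomogConst γ₁ γ₂ c (A.map constantCoeff) := by
  intro a b h
  have := hA a b (d := 0) h
  rw [map_zero] at this
  exact (sub_eq_zero.mp this.symm)

lemma isHomog_one [DecidableEq α] :
    IsHomog w γ₁ γ₁ 0 (1 : Matrix α α (MvPolynomial τ k)) := by
  have := (isHomogConst_one (k := k) (γ₁ := γ₁)).map (w := w)
  rwa [Matrix.map_one _ (map_zero _) (map_one _)] at this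

/-- The inverse is a finite geometric series, each term of which is homogeneous of degree 0. -/
lemma IsHomog.exists_inverse_one_add [Fintype α] [DecidableEq α]
    {N : Matrix α α (MvPolynomial τ k)} (hN : IsHomog w γ₁ γ₁ 0 N) (hnil : IsNilpotent N) :
    ∃ X, IsHomog w γ₁ γ₁ 0 X ∧ X * (1 + N) = 1 ∧ (1 + N) * X = 1 := by
  obtain ⟨r, hr⟩ := hnil
  have hr' : (-N) ^ r = 0 := by rw [neg_pow, hr, mul_zero]
  have hN' : IsHomog w γ₁ γ₁ 0 (-N) := fun a b => (hN a b).neg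
  have hpow : ∀ j : ℕ, IsHomog w γ₁ γ₁ 0 ((-N) ^ j) := by
    intro j
    induction j with
    | zero => exact isHomog_one
    | succ j ih => simpa [pow_succ] using ih.mul hN'
  refine ⟨∑ j ∈ Finset.range r, (-N) ^ j, ?_, ?_, ?_⟩
  · intro a b
    rw [Matrix.sum_apply]
    exact IsWeightedHomogeneous.sum _ _ _ fun j _ => hpow j a b
  · have := geom_sum_mul_neg (-N) r
    rwa [hr', sub_zero, sub_neg_eq_add] at this
  · have := mul_neg_geom_sum (-N) r
    rwa [hr', sub_zero, sub_neg_eq_add] at this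

/-- A matrix that is strictly triangular with respect to a weight function is nilpotent. -/
lemma isNilpotent_of_lt {R : Type*} [CommRing R] [Fintype α] [DecidableEq α] (f : α → ℤ)
    {N : Matrix α α R} (hN : ∀ a b, N a b ≠ 0 → f a < f b) : IsNilpotent N := by
  have hpow : ∀ (j : ℕ) a b, (N ^ j) a b ≠ 0 → f a + j ≤ f b := by
    intro j
    induction j with
    | zero =>
      intro a b h
      have : a = b := by
        by_contra hne
        exact h (Matrix.one_apply_ne hne)
      simp [this]
    | succ j ih =>
      intro a b h
      rw [pow_succ, Matrix.mul_apply] at h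
      obtain ⟨x, -, hx⟩ := Finset.exists_ne_zero_of_sum_ne_zero h
      have h1 := ih a x (left_ne_zero_of_mul hx)
      have h2 := hN x b (right_ne_zero_of_mul hx)
      push_cast
      omega
  -- An exponent larger than every difference `f b - f a`.
  refine ⟨∑ a, (f a).natAbs + ∑ a, (f a).natAbs + 1, ?_⟩
  ext a b
  by_contra h
  have h1 := hpow _ a b h
  have h2 := Finset.single_le_sum (f := fun a => (f a).natAbs) (fun _ _ => Nat.zero_le _)
    (Finset.mem_univ a)
  have h3 := Finset.single_le_sum (f := fun a => (f a).natAbs) (fun _ _ => Nat.zero_le _)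
    (Finset.mem_univ b)
  generalize ∑ a, (f a).natAbs = t at h1 h2 h3
  omega

lemma pos_of_isWeightedHomogeneous {w : τ → Γ} (φ : Γ →+ ℤ) (hw : ∀ l, 0 < φ (w l)) {g : Γ}
    {p : MvPolynomial τ k} (hp : IsWeightedHomogeneous w p g) (h0 : constantCoeff p = 0)
    (hne : p ≠ 0) : 0 < φ g := by
  obtain ⟨m, hm⟩ := MvPolynomial.ne_zero_iff.mp hne
  rw [← hp hm, Finsupp.weight_apply, Finsupp.sum, map_sum]
  have hm0 : m ≠ 0 := by
    rintro rfl
    exact hm h0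
  refine Finset.sum_pos (fun l hl => ?_) (Finsupp.support_nonempty_iff.mpr hm0)
  rw [map_nsmul]
  exact nsmul_pos (hw l) (Finsupp.mem_support_iff.mp hl)

end HomogeneousMatrices

/-! ### Homological perturbation and reduction to a minimal complex -/

section Perturbation

/-- The perturbation of a contraction `h` of the differential `x` into one of `x + δ`. -/
lemma perturbation_identities {A : Type*} [Ring A] {x δ h X : A} (hxx : x * x = 0)
    (hD : (x + δ) * (x + δ) = 0) (hh : h * h = 0)
    (hX : X * (1 + h * δ) = 1) (hX' : (1 + h * δ) * X = 1) :
    (X * h) * (1 + δ * h) = h ∧ (1 + δ * h) * (1 - δ * (X * h)) = 1 ∧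
    h * δ * (X * h) = h - X * h ∧ (X * h) * (X * h) = 0 ∧
    (1 - X * h * δ) * (1 - x * h - h * x) * (1 - δ * (X * h)) =
      1 - (x + δ) * (X * h) - (X * h) * (x + δ) := by
  set H := X * h with hH
  have a1 : H * (1 + δ * h) = h := by
    calc H * (1 + δ * h) = X * (1 + h * δ) * h := by rw [hH]; noncomm_ring
      _ = h := by rw [hX, one_mul]
  have a2 : h * δ * H = h - H := by
    calc h * δ * H = (1 + h * δ) * X * h - H := by rw [hH]; noncomm_ring
      _ = h - H := by rw [hX', one_mul]
  have a2' : H * δ * h = h - H := by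
    calc H * δ * h = H * (1 + δ * h) - H := by noncomm_ring
      _ = h - H := by rw [a1]
  have a3 : h * H = 0 := by
    calc h * H = h * h - h * (h - H) := by noncomm_ring
      _ = h * h - h * h * δ * H := by rw [← a2]; noncomm_ring
      _ = 0 := by rw [hh]; simp
  have a5 : H * H = 0 := by
    nth_rewrite 1 [hH]
    rw [mul_assoc, a3, mul_zero]
  -- The Maurer–Cartan equation of the perturbation; it cancels the term quadratic in `H` in the
  -- last identity.
  have a6 : x * δ + δ * x + δ * δ = 0 := by
    calc x * δ + δ * x + δ * δ = (x + δ) * (x + δ) - x * x := by noncomm_ring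
      _ = 0 := by rw [hD, hxx, sub_zero]
  refine ⟨a1, ?_, a2, a5, ?_⟩
  · calc (1 + δ * h) * (1 - δ * H) = 1 + δ * (h - H - h * δ * H) := by noncomm_ring
      _ = 1 := by rw [a2]; simp
  · calc (1 - H * δ) * (1 - x * h - h * x) * (1 - δ * H) =
        (1 - H * δ) * (1 - δ * H) - (1 - H * δ) * x * (h - h * δ * H)
          - (h - H * δ * h) * x * (1 - δ * H) := by noncomm_ring
      _ = (1 - H * δ) * (1 - δ * H) - (1 - H * δ) * x * H - H * x * (1 - δ * H) := by
          rw [a2, a2']; simp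
      _ = 1 - (x + δ) * H - H * (x + δ) + H * (x * δ + δ * x + δ * δ) * H := by noncomm_ring
      _ = _ := by rw [a6]; simp

variable {k Γ τ ι : Type*} [Field k] [AddCommGroup Γ] [Fintype ι] [DecidableEq ι]

/-- A homotopy equivalence between a complex of graded free modules, given by the matrix `D` of
its differential, and a minimal complex with the differential `D₁`, together with a
constant nondegenerate form `J₁` for which `D₁` is selfadjoint. -/
structure MinimalReduction (w : τ → Γ) (γ : ι → Γ) (ω g₀ : Γ) (σ : ℤ)
    (D : Matrix ι ι (MvPolynomial τ k)) where
  index : Finset ι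
  D₁ : Matrix index index (MvPolynomial τ k)
  J₁ : Matrix index index (MvPolynomial τ k)
  K₁ : Matrix index index (MvPolynomial τ k)
  I : Matrix ι index (MvPolynomial τ k)
  P : Matrix index ι (MvPolynomial τ k)
  H : Matrix ι ι (MvPolynomial τ k)
  P_mul_I : P * I = 1
  I_mul_P : I * P = 1 - D * H - H * D
  D_mul_I : D * I = I * D₁
  P_mul_D : P * D = D₁ * P
  D₁_homog : IsHomog w (fun a : index => γ a) (fun a : index => γ a) (-ω) D₁
  I_homog : IsHomog w γ (fun a : index => γ a) 0 I
  H_homog : IsHomog w γ γ ω H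
  K₁_homog : IsHomog w (fun a : index => γ a) (fun a : index => g₀ - γ a) 0 K₁
  D₁_minimal : ∀ a b, constantCoeff (D₁ a b) = 0
  D₁_selfadjoint : D₁ᵀ * J₁ = J₁ * D₁
  J₁_mul_K₁ : J₁ * K₁ = 1
  K₁_transpose : K₁ᵀ = σ • K₁

/-- The homology of the constant part of `D` is split off by a selfadjoint projection over `k`, and
the perturbation lemma deforms this splitting into one for `D`. Selfadjointness of the contraction
is what keeps the transferred form constant, hence invertible by an explicit constant matrix. -/
theorem exists_minimalReduction (h2 : (2 : k) ≠ 0) {w : τ → Γ} {γ : ι → Γ} {ω g₀ : Γ} {σ : ℤ}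
    (φ : Γ →+ ℤ) (hφ : φ ω = 0) (hw : ∀ l, 0 < φ (w l)) {D : Matrix ι ι (MvPolynomial τ k)}
    (hD : IsHomog w γ γ (-ω) D) (hDD : D * D = 0) {J J' : Matrix ι ι k} (hJJ' : J * J' = 1)
    (hJ : IsHomogConst (fun a => g₀ - γ a) γ 0 J) (hσ : σ * σ = 1) (hJt : Jᵀ = σ • J)
    (hDJ : Dᵀ * J.map C = J.map C * D) : Nonempty (MinimalReduction w γ ω g₀ σ D) := by
  classical
  set x := D.map constantCoeff with hx_def
  have hx : IsHomogConst γ γ (-ω) x := hD.map_constantCoeff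
  have hxx : x * x = 0 := by
    rw [hx_def, ← Matrix.map_mul, hDD, Matrix.map_zero _ (map_zero _)]
  have hxJ : xᵀ * J = J * x := by
    have hJC : (J.map (C : k →+* MvPolynomial τ k)).map constantCoeff = J := by ext; simp
    have := congrArg (fun A => A.map (constantCoeff (R := k) (σ := τ))) hDJ
    simpa only [Matrix.map_mul, hJC, Matrix.transpose_map, ← hx_def] using this
  have hJ' := hJ.of_mul_eq_one hJJ'
  obtain ⟨h, hh, hhh, hxhx, hhxh, hhJ⟩ :=
    exists_selfadjoint_contraction h2 hx hxx hJJ' hJ hxJ hσ hJt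
  -- the projection to the homology of the constant part
  set e := 1 - x * h - h * x with he_def
  have he : IsHomogConst γ γ 0 e :=
    (isHomogConst_one.sub (by simpa using hx.mul hh)).sub (by simpa using hh.mul hx)
  have hhe : h * e = 0 := by
    rw [he_def, mul_sub, mul_sub, ← mul_assoc, ← mul_assoc, hhxh, hhh]; simp
  have heh : e * h = 0 := by
    rw [he_def, sub_mul, sub_mul, mul_assoc, hhh, hhxh]; simp
  have hxe : x * e = 0 := by
    rw [he_def, mul_sub, mul_sub, ← mul_assoc, ← mul_assoc, hxhx, hxx]; simp
  have hee : e * e = e := by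
    nth_rewrite 1 [he_def]
    rw [sub_mul, sub_mul, mul_assoc, mul_assoc, hhe, hxe]; simp
  have heJ : J * e = eᵀ * J := by
    rw [he_def, transpose_sub, transpose_sub, transpose_mul, transpose_mul, transpose_one,
      mul_sub, mul_sub, sub_mul, sub_mul, mul_assoc hᵀ, hxJ, ← mul_assoc hᵀ, hhJ,
      mul_assoc xᵀ, hhJ, ← mul_assoc xᵀ, hxJ, mul_assoc, mul_assoc, one_mul, mul_one]
    abel
  obtain ⟨s, i, p, hi, hp, hpi, hip⟩ := he.exists_splitting hee
  have hei : e * i = i := by rw [← hip, Matrix.mul_assoc, hpi, Matrix.mul_one]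
  have hpe : p * e = p := by rw [← hip, ← Matrix.mul_assoc, hpi, Matrix.one_mul]
  have hhi : h * i = 0 := by rw [← hei, ← Matrix.mul_assoc, hhe, Matrix.zero_mul]
  have hxi : x * i = 0 := by rw [← hei, ← Matrix.mul_assoc, hxe, Matrix.zero_mul]
  have hph : p * h = 0 := by rw [← hpe, Matrix.mul_assoc, heh, Matrix.mul_zero]
  -- As `e` is selfadjoint, its image and kernel are orthogonal, so `J` stays nondegenerate on the
  -- image.
  have hJpi : iᵀ * J * i * (p * J' * pᵀ) = 1 := by
    calc iᵀ * J * i * (p * J' * pᵀ) = iᵀ * (J * (i * p)) * J' * pᵀ := by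
          simp only [Matrix.mul_assoc]
      _ = (e * i)ᵀ * (J * J') * pᵀ := by
          rw [hip, heJ, transpose_mul]; simp only [Matrix.mul_assoc]
      _ = 1 := by rw [hei, hJJ', Matrix.mul_one, ← transpose_mul, hpi, transpose_one]
  -- extension of scalars to the polynomial ring
  let cc : k →+* MvPolynomial τ k := C
  have hK : IsHomogConst (fun a : s => γ a) (fun a : s => g₀ - γ a) 0 (p * J' * pᵀ) := by
    simpa using (hp.mul hJ').mul (hp.transpose g₀)
  set δ := D - x.map cc with hδ_def
  have hxδ : x.map cc + δ = D := by rw [hδ_def]; abel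
  have hδ0 : δ.map constantCoeff = 0 := by
    ext a b
    simp [hδ_def, hx_def, cc]
  have hδ : IsHomog w γ γ (-ω) δ := hD.sub hx.map
  have hxx' : x.map cc * x.map cc = 0 := by
    rw [← Matrix.map_mul, hxx, Matrix.map_zero _ (map_zero _)]
  have hhh' : h.map cc * h.map cc = 0 := by
    rw [← Matrix.map_mul, hhh, Matrix.map_zero _ (map_zero _)]
  have hhi' : h.map cc * i.map cc = 0 := by
    rw [← Matrix.map_mul, hhi, Matrix.map_zero _ (map_zero _)]
  have hph' : p.map cc * h.map cc = 0 := by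
    rw [← Matrix.map_mul, hph, Matrix.map_zero _ (map_zero _)]
  have hpi' : p.map cc * i.map cc = 1 := by
    rw [← Matrix.map_mul, hpi, Matrix.map_one _ (map_zero _) (map_one _)]
  have hip' : i.map cc * p.map cc = 1 - x.map cc * h.map cc - h.map cc * x.map cc := by
    rw [← Matrix.map_mul, hip, he_def, Matrix.map_sub _ (map_sub _), Matrix.map_sub _ (map_sub _),
      Matrix.map_one _ (map_zero _) (map_one _), Matrix.map_mul, Matrix.map_mul]
  have hhJ' : (h.map cc)ᵀ * J.map cc = J.map cc * h.map cc := by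
    rw [← Matrix.transpose_map, ← Matrix.map_mul, hhJ, Matrix.map_mul]
  have hδJ : δᵀ * J.map cc = J.map cc * δ := by
    rw [hδ_def, transpose_sub, Matrix.sub_mul, Matrix.mul_sub, ← Matrix.transpose_map,
      ← Matrix.map_mul, hxJ, Matrix.map_mul, hDJ]
  have hN : IsHomog w γ γ 0 (h.map cc * δ) := by simpa using (hh.map (w := w)).mul hδ
  -- Under `φ`, the constant matrix `h` preserves degrees because `φ ω = 0`, while the entries of
  -- `δ` have no constant term and hence positive degree. So the product is strictly triangular.
  have hnil : IsNilpotent (h.map cc * δ) := by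
    refine isNilpotent_of_lt (fun a => φ (γ a)) fun a b hab => ?_
    rw [Matrix.mul_apply] at hab
    obtain ⟨y, -, hy⟩ := Finset.exists_ne_zero_of_sum_ne_zero hab
    have h1 : h a y ≠ 0 := by
      rintro h0
      exact hy (by simp [h0])
    have h2 := pos_of_isWeightedHomogeneous φ hw (hδ y b)
      (congrFun (congrFun hδ0 y) b) (right_ne_zero_of_mul hy)
    have h3 := hh a y h1
    simp only [← h3, map_add, map_sub, map_neg, hφ] at h2 ⊢
    omega
  obtain ⟨X, hX, hX1, hX2⟩ := hN.exists_inverse_one_add hnil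
  obtain ⟨b1, b2, b3, b4, b5⟩ :=
    perturbation_identities hxx' (by rw [hxδ, hDD]) hhh' hX1 hX2
  have hH : IsHomog w γ γ ω (X * h.map cc) := by simpa using hX.mul (hh.map (w := w))
  have hHi : X * h.map cc * i.map cc = 0 := by rw [Matrix.mul_assoc, hhi', Matrix.mul_zero]
  rw [hxδ] at b5
  generalize hH_def : X * h.map cc = H at b1 b2 b3 b4 b5 hH hHi
  have hpH : p.map cc * H = 0 := by
    have : H = h.map cc - h.map cc * δ * H := by rw [b3]; abel
    rw [this, Matrix.mul_sub, ← Matrix.mul_assoc, ← Matrix.mul_assoc, hph']; simp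
  -- Both sides become equal after multiplication by `1 + δ * h`, which has the right inverse `1 - δ
  -- * H`.
  have hHJ : Hᵀ * J.map cc = J.map cc * H := by
    have h1 : Hᵀ * J.map cc * (1 + δ * h.map cc) = J.map cc * H * (1 + δ * h.map cc) := by
      have h3 : (1 + h.map cc * δ) * H = h.map cc := by
        rw [Matrix.add_mul, b3, Matrix.one_mul]; abel
      have h4 : (1 + h.map cc * δ)ᵀ * J.map cc = J.map cc * (1 + δ * h.map cc) := by
        rw [transpose_add, transpose_mul, transpose_one, add_mul, mul_add, mul_assoc, hhJ',
          ← mul_assoc, hδJ, mul_assoc, one_mul, mul_one]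
      rw [mul_assoc, ← h4, ← mul_assoc, ← transpose_mul, h3, hhJ', mul_assoc, b1]
    have h5 := congrArg (fun A => A * (1 - δ * H)) h1
    simpa only [mul_assoc, b2, mul_one] using h5
  set I := (1 - H * δ) * i.map cc with hI_def
  set P := p.map cc * (1 - δ * H) with hP_def
  have hPI : P * I = 1 := by
    calc P * I = p.map cc * i.map cc - (p.map cc * H) * δ * i.map cc - p.map cc * δ * (H * i.map cc)
          + p.map cc * δ * (H * H) * δ * i.map cc := by
          rw [hI_def, hP_def]
          simp only [Matrix.mul_sub, Matrix.sub_mul, Matrix.mul_assoc, Matrix.one_mul]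
          abel
      _ = 1 := by rw [hHi, hpH, b4, hpi']; simp
  have hIP : I * P = 1 - D * H - H * D := by
    rw [← b5, ← hip', hI_def, hP_def]
    simp only [Matrix.mul_assoc]
  have hcomm : D * (1 - D * H - H * D) = (1 - D * H - H * D) * D := by
    rw [mul_sub, mul_sub, sub_mul, sub_mul, ← mul_assoc D D, mul_assoc H D D, hDD, zero_mul,
      mul_zero, mul_one, one_mul, sub_zero, sub_zero, mul_assoc]
  -- `I * P` commutes with `D`, being homotopic to the identity; therefore `P * D * I` is a
  -- differential for which `I` and `P` are chain maps.
  have hDI : D * I = I * (P * D * I) := by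
    calc D * I = D * I * (P * I) := by rw [hPI, Matrix.mul_one]
      _ = D * (I * P) * I := by simp only [Matrix.mul_assoc]
      _ = I * (P * D * I) := by rw [hIP, hcomm, ← hIP]; simp only [Matrix.mul_assoc]
  have hPD : P * D = P * D * I * P := by
    calc P * D = P * I * (P * D) := by rw [hPI, Matrix.one_mul]
      _ = P * (I * P * D) := by simp only [Matrix.mul_assoc]
      _ = P * D * I * P := by rw [hIP, ← hcomm, ← hIP]; simp only [Matrix.mul_assoc]
  have hI : IsHomog w γ (fun a : s => γ a) 0 I := by
    simpa using (isHomog_one.sub (by simpa using hH.mul hδ)).mul (hi.map (w := w))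
  have hP : IsHomog w (fun a : s => γ a) γ 0 P := by
    simpa using (hp.map (w := w)).mul (isHomog_one.sub (by simpa using hδ.mul hH))
  refine ⟨⟨s, P * D * I, Iᵀ * J.map cc * I, (p * J' * pᵀ).map cc, I, P, H, hPI, hIP, hDI, hPD, ?_,
    hI, hH, hK.map, ?_, ?_, ?_, ?_⟩⟩
  · simpa using (hP.mul hD).mul hI
  · have h1 : (P * D * I).map constantCoeff = p * x * i := by
      have hp0 : (p.map cc).map constantCoeff = p := by ext; simp [cc]
      have hi0 : (i.map cc).map constantCoeff = i := by ext; simp [cc]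
      rw [Matrix.map_mul, Matrix.map_mul, hI_def, hP_def, Matrix.map_mul, Matrix.map_mul,
        Matrix.map_sub _ (map_sub _), Matrix.map_sub _ (map_sub _), Matrix.map_mul, Matrix.map_mul,
        hδ0, Matrix.map_one _ (map_zero _) (map_one _), hp0, hi0, ← hx_def]
      simp
    rw [Matrix.mul_assoc p, hxi, Matrix.mul_zero] at h1
    exact fun a b => congrFun (congrFun h1 a) b
  · calc (P * D * I)ᵀ * (Iᵀ * J.map cc * I) = (I * (P * D * I))ᵀ * J.map cc * I := by
          rw [transpose_mul I]; simp only [Matrix.mul_assoc]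
      _ = Iᵀ * (Dᵀ * J.map cc) * I := by
          rw [← hDI, transpose_mul]; simp only [Matrix.mul_assoc]
      _ = Iᵀ * J.map cc * (D * I) := by rw [hDJ]; simp only [Matrix.mul_assoc]; rfl
      _ = Iᵀ * J.map cc * I * (P * D * I) := by rw [hDI]; simp only [Matrix.mul_assoc]
  -- The correction terms disappear by `H * i = 0`, `H * H = 0` and selfadjointness of `H`, so the
  -- deformed inclusion pulls `J` back to the same constant form as `i` does.
  · have h1 : Iᵀ * J.map cc * I = (iᵀ * J * i).map cc := by
      calc Iᵀ * J.map cc * I = (i.map cc)ᵀ * (((1 - H * δ)ᵀ * J.map cc) * (1 - H * δ)) *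
            i.map cc := by rw [hI_def, transpose_mul]; simp only [Matrix.mul_assoc]
        _ = (i.map cc)ᵀ * ((J.map cc * (1 - δ * H)) * (1 - H * δ)) * i.map cc := by
          rw [transpose_sub, transpose_mul, transpose_one, sub_mul, mul_assoc, hHJ, ← mul_assoc,
            hδJ, mul_assoc, one_mul, ← mul_one_sub]
        _ = (i.map cc)ᵀ * J.map cc * i.map cc - (i.map cc)ᵀ * J.map cc * δ * (H * i.map cc)
            - (i.map cc)ᵀ * (J.map cc * H) * δ * i.map cc
            + (i.map cc)ᵀ * J.map cc * δ * (H * H) * δ * i.map cc := by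
          simp only [Matrix.mul_sub, Matrix.sub_mul, Matrix.mul_assoc, Matrix.one_mul]
          abel
        _ = (i.map cc)ᵀ * J.map cc * i.map cc := by
          rw [← hHJ, ← Matrix.mul_assoc _ Hᵀ, ← transpose_mul, hHi, b4]; simp
        _ = (iᵀ * J * i).map cc := by
          rw [Matrix.map_mul, Matrix.map_mul, ← Matrix.transpose_map]
    rw [h1, ← Matrix.map_mul, hJpi, Matrix.map_one _ (map_zero _) (map_one _)]
  · have hJ't := transpose_eq_smul_of_mul_eq_one hJJ' hσ hJt
    rw [← Matrix.transpose_map, transpose_mul, transpose_mul, transpose_transpose, hJ't,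
      ← Matrix.mul_assoc, Matrix.mul_smul, Matrix.smul_mul]
    exact Matrix.ext fun a b => map_zsmul cc σ _

end Perturbation
-- The exterior algebra, its selfduality, and exactness of Koszul complexes
section Koszul

variable {n : ℕ}

/-- The sign of `e_l ∧ e_S` for `l ∉ S`. -/
def koszulSign (l : Fin n) (S : Finset (Fin n)) : ℤ := (-1) ^ (S.filter (· < l)).card

lemma koszulSign_mul_self (l : Fin n) (S : Finset (Fin n)) :
    koszulSign l S * koszulSign l S = 1 := by
  rw [koszulSign, ← pow_add, Even.neg_one_pow ⟨_, rfl⟩]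

lemma koszulSign_insert {j l : Fin n} {S : Finset (Fin n)} (hj : j ∉ S) :
    koszulSign l (insert j S) = if j < l then -koszulSign l S else koszulSign l S := by
  unfold koszulSign
  rw [Finset.filter_insert]
  split_ifs with h
  · rw [Finset.card_insert_of_notMem (by simp [hj]), pow_succ, mul_neg_one]
  · rfl

lemma koszulSign_erase {j l : Fin n} {S : Finset (Fin n)} (hj : j ∈ S) :
    koszulSign l (S.erase j) = if j < l then -koszulSign l S else koszulSign l S := by
  conv_rhs => rw [← Finset.insert_erase hj, koszulSign_insert (Finset.notMem_erase j S)]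
  split_ifs <;> simp

/-- The matrix of the contraction with `e_l^*` on the exterior algebra. -/
def contraction (l : Fin n) : Matrix (Finset (Fin n)) (Finset (Fin n)) ℤ :=
  Matrix.of fun S T => if l ∉ S ∧ T = insert l S then koszulSign l S else 0

lemma contraction_mul_apply {κ : Type*} (l : Fin n) (A : Matrix (Finset (Fin n)) κ ℤ) (S) (T) :
    (contraction l * A) S T = if l ∈ S then 0 else koszulSign l S * A (insert l S) T := by
  rw [Matrix.mul_apply]
  by_cases h : l ∈ S <;> simp [contraction, h, ite_mul]

lemma transpose_contraction_apply (l : Fin n) (S T : Finset (Fin n)) :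
    (contraction l)ᵀ S T = if l ∈ S ∧ T = S.erase l then koszulSign l S else 0 := by
  rw [Matrix.transpose_apply, contraction, Matrix.of_apply]
  by_cases h : l ∈ S ∧ T = S.erase l
  · rw [if_pos h, h.2, if_pos ⟨Finset.notMem_erase l S, (Finset.insert_erase h.1).symm⟩,
      koszulSign_erase h.1, if_neg (lt_irrefl l)]
  · rw [if_neg h, if_neg]
    rintro ⟨h1, rfl⟩
    exact h ⟨Finset.mem_insert_self _ _, (Finset.erase_insert h1).symm⟩

lemma transpose_contraction_mul_apply {κ : Type*} (l : Fin n) (A : Matrix (Finset (Fin n)) κ ℤ)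
    (S) (T) :
    ((contraction l)ᵀ * A) S T = if l ∈ S then koszulSign l S * A (S.erase l) T else 0 := by
  rw [Matrix.mul_apply]
  simp only [transpose_contraction_apply]
  by_cases h : l ∈ S <;> simp [h, ite_mul]

lemma contraction_mul_contraction (l j : Fin n) :
    contraction l * contraction j = -(contraction j * contraction l) := by
  ext S T
  rw [Matrix.neg_apply, contraction_mul_apply, contraction_mul_apply]
  simp only [contraction, Matrix.of_apply]
  by_cases hl : l ∈ S <;> by_cases hj : j ∈ S <;> simp only [hl, hj, if_true, if_false,
    Finset.mem_insert, or_true, not_true, false_and, mul_zero, neg_zero, or_false]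
  rcases lt_trichotomy l j with h | rfl | h
  · simp only [h.ne, h.ne', not_false_eq_true, true_and, koszulSign_insert hl,
      koszulSign_insert hj, if_pos h, if_neg h.asymm, Finset.insert_comm j l]
    split_ifs <;> ring
  · simp
  · simp only [h.ne, h.ne', not_false_eq_true, true_and, koszulSign_insert hl,
      koszulSign_insert hj, if_pos h, if_neg h.asymm, Finset.insert_comm j l]
    split_ifs <;> ring

lemma contraction_mul_transpose_self_apply (j : Fin n) (S T : Finset (Fin n)) :
    (contraction j * (contraction j)ᵀ) S T = if j ∉ S ∧ S = T then 1 else 0 := by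
  rw [contraction_mul_apply, transpose_contraction_apply]
  by_cases hj : j ∈ S
  · simp [hj]
  · have h1 : koszulSign j (insert j S) = koszulSign j S := by
      rw [koszulSign_insert hj, if_neg (lt_irrefl j)]
    simp [hj, h1, koszulSign_mul_self, eq_comm]

lemma contraction_mul_transpose_self_add (j : Fin n) :
    contraction j * (contraction j)ᵀ + (contraction j)ᵀ * contraction j = 1 := by
  ext S T
  rw [Matrix.add_apply, contraction_mul_transpose_self_apply, transpose_contraction_mul_apply,
    contraction, Matrix.of_apply, Matrix.one_apply]
  by_cases hj : j ∈ S
  · have h1 : koszulSign j (S.erase j) = koszulSign j S := by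
      rw [koszulSign_erase hj, if_neg (lt_irrefl j)]
    simp [hj, h1, koszulSign_mul_self, Finset.insert_erase hj, eq_comm]
  · simp [hj]

lemma contraction_mul_transpose (l j : Fin n) (h : l ≠ j) :
    contraction l * (contraction j)ᵀ = -((contraction j)ᵀ * contraction l) := by
  ext S T
  rw [Matrix.neg_apply, contraction_mul_apply, transpose_contraction_mul_apply,
    transpose_contraction_apply, contraction, Matrix.of_apply]
  by_cases hl : l ∈ S
  · by_cases hj : j ∈ S <;> simp [hl, hj, h]
  by_cases hj : j ∈ S
  · simp only [hl, hj, if_true, if_false, Finset.mem_insert, or_true, true_and, Finset.mem_erase,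
      and_false, not_false_eq_true, koszulSign_insert hl, koszulSign_erase hj,
      Finset.erase_insert_of_ne h]
    rcases lt_or_gt_of_ne h with h | h
    · simp only [if_pos h, if_neg h.asymm]
      split_ifs <;> ring
    · simp only [if_pos h, if_neg h.asymm]
      split_ifs <;> ring
  · simp [hl, hj, h.symm]

/-- The matrix of the form `(e_S, e_T) ↦ ± e_S ∧ e_T`, with signs that make all contractions
selfadjoint. -/
def koszulForm (n : ℕ) : Matrix (Finset (Fin n)) (Finset (Fin n)) ℤ :=
  Matrix.of fun S T => if T = Sᶜ then (-1) ^ (∑ l ∈ S, (l : ℕ)) else 0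

lemma koszulForm_mul_transpose : koszulForm n * (koszulForm n)ᵀ = 1 := by
  ext S T
  rw [Matrix.mul_apply, Matrix.one_apply]
  simp only [koszulForm, Matrix.transpose_apply, Matrix.of_apply, ite_mul, zero_mul]
  rw [Finset.sum_ite_eq' Finset.univ Sᶜ, if_pos (Finset.mem_univ _)]
  by_cases h : S = T
  · rw [h, if_pos rfl, if_pos rfl, ← pow_add, Even.neg_one_pow ⟨_, rfl⟩]
  · rw [if_neg (by simpa using h), if_neg h, mul_zero]

/-- The sign comes from comparing the exponents of `S` and its complement, whose sum is `0 + ⋯ + 2m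
= m(2m + 1)`, of the parity of `m`. -/
lemma transpose_koszulForm {m : ℕ} (hn : n = 2 * m + 1) :
    (koszulForm n)ᵀ = ((-1) ^ m : ℤ) • koszulForm n := by
  ext S T
  simp only [koszulForm, Matrix.transpose_apply, Matrix.of_apply, Matrix.smul_apply, smul_eq_mul]
  by_cases h : T = Sᶜ
  · have h' : S = Tᶜ := by rw [h, compl_compl]
    rw [if_pos h', if_pos h, h]
    have h1 : ∑ l ∈ S, (l : ℕ) + ∑ l ∈ Sᶜ, (l : ℕ) = m * (2 * m + 1) := by
      rw [Finset.sum_add_sum_compl, Fin.sum_univ_eq_sum_range (fun i => i), Finset.sum_range_id, hn]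
      have : (2 * m + 1) * (2 * m + 1 - 1) = 2 * (m * (2 * m + 1)) := by
        rw [Nat.add_sub_cancel]; ring
      rw [this, Nat.mul_div_cancel_left _ two_pos]
    have h2 : ((-1) ^ (∑ l ∈ S, (l : ℕ)) * (-1) ^ (∑ l ∈ Sᶜ, (l : ℕ)) : ℤ) = (-1) ^ m := by
      rw [← pow_add, h1, mul_comm, pow_mul, pow_succ, pow_mul]
      norm_num
    have h3 : ((-1) ^ (∑ l ∈ S, (l : ℕ)) * (-1) ^ (∑ l ∈ S, (l : ℕ)) : ℤ) = 1 := by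
      rw [← pow_add, Even.neg_one_pow ⟨_, rfl⟩]
    rw [← h2]
    linear_combination -((-1) ^ (∑ l ∈ Sᶜ, (l : ℕ)) : ℤ) * h3
  · have h' : ¬ S = Tᶜ := fun h0 => h (by rw [h0, compl_compl])
    rw [if_neg h, if_neg h', mul_zero]

lemma transpose_contraction_mul_koszulForm (l : Fin n) :
    (contraction l)ᵀ * koszulForm n = koszulForm n * contraction l := by
  ext S T
  rw [transpose_contraction_mul_apply, Matrix.mul_apply]
  simp only [koszulForm, Matrix.of_apply, ite_mul, zero_mul]
  rw [Finset.sum_ite_eq' Finset.univ Sᶜ, if_pos (Finset.mem_univ _), contraction, Matrix.of_apply]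
  by_cases hl : l ∈ S
  · have h1 : koszulSign l S * koszulSign l Sᶜ = (-1) ^ (l : ℕ) := by
      rw [koszulSign, koszulSign, ← pow_add, ← Finset.card_union_of_disjoint, ← Finset.filter_union,
        Finset.union_compl]
      · have : (Finset.univ.filter (· < l)) = Finset.Iio l := by ext; simp
        rw [this, Fin.card_Iio]
      · exact Finset.disjoint_filter_filter disjoint_compl_right
    have h2 : ((-1) ^ (∑ l ∈ S, (l : ℕ)) : ℤ) =
        (-1) ^ (l : ℕ) * (-1) ^ (∑ l ∈ S.erase l, (l : ℕ)) := by
      rw [← pow_add, Finset.add_sum_erase S (fun l => (l : ℕ)) hl]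
    simp only [hl, if_true, Finset.mem_compl, not_true, not_false_eq_true, true_and,
      Finset.compl_erase]
    split_ifs
    · rw [h2, ← h1]
      linear_combination -(koszulSign l S * (-1) ^ (∑ l ∈ S.erase l, (l : ℕ)) : ℤ) *
        koszulSign_mul_self l Sᶜ
    · simp
  · simp [hl]

variable {A N : Type*} [CommRing A] [AddCommGroup N] [Module A N]

/-- The tensor product of an endomorphism with an integral matrix. -/
def tensorEnd (f : Module.End A N) (B : Matrix (Finset (Fin n)) (Finset (Fin n)) ℤ) :
    Module.End A (Finset (Fin n) → N) where
  toFun z S := ∑ T, B S T • f (z T)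
  map_add' x y := by ext; simp [Finset.sum_add_distrib]
  map_smul' r x := by ext; simp [Finset.smul_sum, smul_comm r]

lemma tensorEnd_apply (f : Module.End A N) (B) (z : Finset (Fin n) → N) (S) :
    tensorEnd f B z S = ∑ T, B S T • f (z T) := rfl

lemma tensorEnd_mul (f g : Module.End A N) (B C : Matrix (Finset (Fin n)) (Finset (Fin n)) ℤ) :
    tensorEnd f B * tensorEnd g C = tensorEnd (f * g) (B * C) := by
  refine LinearMap.ext fun z => funext fun S => ?_
  simp only [Module.End.mul_apply, tensorEnd_apply, map_sum, map_zsmul, Matrix.mul_apply,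
    Finset.smul_sum, Finset.sum_smul, smul_smul]
  exact Finset.sum_comm

lemma tensorEnd_add_right (f : Module.End A N) (B C) :
    tensorEnd (n := n) f (B + C) = tensorEnd f B + tensorEnd f C := by
  refine LinearMap.ext fun z => funext fun S => ?_
  simp [tensorEnd_apply, add_smul, Finset.sum_add_distrib]

lemma tensorEnd_neg_right (f : Module.End A N) (B) :
    tensorEnd (n := n) f (-B) = -tensorEnd f B := by
  refine LinearMap.ext fun z => funext fun S => ?_
  simp [tensorEnd_apply]

lemma tensorEnd_sub_left (f g : Module.End A N) (B) :
    tensorEnd (n := n) (f - g) B = tensorEnd f B - tensorEnd g B := by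
  refine LinearMap.ext fun z => funext fun S => ?_
  simp [tensorEnd_apply, smul_sub, Finset.sum_sub_distrib]

lemma tensorEnd_one : tensorEnd (n := n) (1 : Module.End A N) 1 = 1 := by
  refine LinearMap.ext fun z => funext fun S => ?_
  simp [tensorEnd_apply, Matrix.one_apply]

/-- The differential of the Koszul complex of a family of endomorphisms. -/
def koszulEnd (f : Fin n → Module.End A N) : Module.End A (Finset (Fin n) → N) :=
  ∑ l, tensorEnd (f l) (contraction l)

lemma koszulEnd_apply (f : Fin n → Module.End A N) (z S) :
    koszulEnd f z S = ∑ l, if l ∈ S then 0 else koszulSign l S • f l (z (insert l S)) := by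
  rw [koszulEnd, LinearMap.sum_apply, Finset.sum_apply]
  refine Finset.sum_congr rfl fun l _ => ?_
  rw [tensorEnd_apply]
  by_cases h : l ∈ S <;> simp [contraction, h, ite_smul]

/-- All terms with `l ≠ j` cancel by anticommutation, so a left inverse of a single `f j` already
provides a homotopy, which pushes cycles off the sets containing `j`. -/
lemma koszulEnd_homotopy (f h : Fin n → Module.End A N) (hf : ∀ j, h j * f j = 1)
    (hc : ∀ i j, i ≠ j → h j * f i = f i * h j) (j : Fin n) :
    koszulEnd f * tensorEnd (h j) (contraction j)ᵀ + tensorEnd (h j) (contraction j)ᵀ * koszulEnd f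
      = 1 - tensorEnd (1 - f j * h j) (contraction j * (contraction j)ᵀ) := by
  have h1 : ∀ l, tensorEnd (f l) (contraction l) * tensorEnd (h j) (contraction j)ᵀ +
      tensorEnd (h j) (contraction j)ᵀ * tensorEnd (f l) (contraction l) =
      if l = j then 1 - tensorEnd (1 - f j * h j) (contraction j * (contraction j)ᵀ) else 0 := by
    intro l
    rw [tensorEnd_mul, tensorEnd_mul]
    split_ifs with hl
    · rw [hl, hf, tensorEnd_sub_left, ← tensorEnd_one, ← contraction_mul_transpose_self_add j,
        tensorEnd_add_right]
      abel
    · rw [hc l j hl, contraction_mul_transpose l j hl, tensorEnd_neg_right, neg_add_cancel]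
  rw [koszulEnd, Finset.sum_mul, Finset.mul_sum, ← Finset.sum_add_distrib,
    Finset.sum_congr rfl fun l _ => h1 l]
  simp

/-- Exactness of the Koszul complex, for endomorphisms with left inverses that
commute with the other endomorphisms. -/
theorem exists_koszulEnd_eq (f h : Fin n → Module.End A N) (hf : ∀ j, h j * f j = 1)
    (hc : ∀ i j, i ≠ j → h j * f i = f i * h j) (hDD : koszulEnd f * koszulEnd f = 0)
    {z : Finset (Fin n) → N} (hz : koszulEnd f z = 0) (hz0 : ∃ v : Fin n → N, z ∅ = ∑ l, f l (v l)) :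
    ∃ w, koszulEnd f w = z := by
  have hDD' : ∀ w, koszulEnd f (koszulEnd f w) = 0 := fun w => DFunLike.congr_fun hDD w
  have step : ∀ B : Finset (Fin n), ∃ w, ∀ S, (∃ l ∈ B, l ∈ S) → (z - koszulEnd f w) S = 0 := by
    intro B
    induction B using Finset.induction_on with
    | empty => exact ⟨0, by simp⟩
    | insert j B _ ih =>
      obtain ⟨w, hw⟩ := ih
      set y := z - koszulEnd f w with hy
      have hDy : koszulEnd f y = 0 := by rw [hy, map_sub, hz, hDD', sub_zero]
      -- The homotopy replaces `y` by `(1 - f j * h j) y` on the sets without `j` and by zero on the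
      -- others, so the vanishing already achieved for `B` persists.
      refine ⟨w + tensorEnd (h j) (contraction j)ᵀ y, fun S hS => ?_⟩
      have h1 := DFunLike.congr_fun (koszulEnd_homotopy f h hf hc j) y
      simp only [LinearMap.add_apply, Module.End.mul_apply, hDy, map_zero, add_zero,
        LinearMap.sub_apply, Module.End.one_apply] at h1
      rw [map_add, ← sub_sub, ← hy, h1, sub_sub_cancel, tensorEnd_apply]
      refine Finset.sum_eq_zero fun T _ => ?_
      rw [contraction_mul_transpose_self_apply]
      split_ifs with hjS
      · obtain ⟨hjS, rfl⟩ := hjS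
        obtain ⟨l, hl, hlS⟩ := hS
        have hl' : l ∈ B := by
          rcases Finset.mem_insert.mp hl with rfl | h
          · exact absurd hlS hjS
          · exact h
        rw [hw S ⟨l, hl', hlS⟩, map_zero, smul_zero]
      · rw [zero_smul]
  obtain ⟨w, hw⟩ := step Finset.univ
  obtain ⟨v, hv⟩ := hz0
  -- The remainder `z - koszulEnd f w` now lives only at `∅`. A correction supported on singletons
  -- affects no other entry.
  let u : Finset (Fin n) → N := fun S => ∑ l, if S = {l} then v l - w {l} else 0
  have hu : ∀ l, u {l} = v l - w {l} := fun l => by simp [u]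
  have hempty : ∀ y : Finset (Fin n) → N, koszulEnd f y ∅ = ∑ l, f l (y {l}) := fun y => by
    simp [koszulEnd_apply, koszulSign]
  refine ⟨w + u, ?_⟩
  ext S
  rcases S.eq_empty_or_nonempty with rfl | hS
  · simp [hempty, hu, hv]
  · obtain ⟨l, hl⟩ := hS
    have h1 := hw S ⟨l, Finset.mem_univ l, hl⟩
    rw [Pi.sub_apply, sub_eq_zero] at h1
    rw [map_add, Pi.add_apply, ← h1, koszulEnd_apply f u, Finset.sum_eq_zero, add_zero]
    intro i _
    split_ifs with hi
    · rfl
    · have : u (insert i S) = 0 := by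
        refine Finset.sum_eq_zero fun t _ => if_neg fun ht => hi ?_
        have h2 : i ∈ ({t} : Finset (Fin n)) := ht ▸ Finset.mem_insert_self i S
        have h3 : l ∈ ({t} : Finset (Fin n)) := ht ▸ Finset.mem_insert_of_mem hl
        rw [Finset.mem_singleton] at h2 h3
        rwa [h2, ← h3]
      rw [this, map_zero, smul_zero]

end Koszul
-- The Koszul differential as a matrix
section KoszulMatrix

variable {n : ℕ} {R α : Type*} [CommRing R] [Fintype α]

/-- The matrix of the differential of the Koszul complex of a family of square matrices. -/
def koszulMatrix (f : Fin n → Matrix α α R) :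
    Matrix (α × Finset (Fin n)) (α × Finset (Fin n)) R :=
  ∑ l, kroneckerMap (· * ·) (f l) ((contraction l).map (Int.castRingHom R))

/-- The matrices commute while the contractions anticommute, so the terms of the double sum cancel
in pairs under swapping the indices. -/
lemma koszulMatrix_mul_self (f : Fin n → Matrix α α R) (hf : ∀ i j, f i * f j = f j * f i) :
    koszulMatrix f * koszulMatrix f = 0 := by
  have h1 : ∀ i j : Fin n,
      kroneckerMap (· * ·) (f i) ((contraction i).map (Int.castRingHom R)) *
        kroneckerMap (· * ·) (f j) ((contraction j).map (Int.castRingHom R)) =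
      kroneckerMap (· * ·) (f i * f j) ((contraction i * contraction j).map (Int.castRingHom R)) :=
    fun i j => by rw [Matrix.map_mul, mul_kronecker_mul]
  have h2 : ∀ (A : Matrix α α R) (B : Matrix (Finset (Fin n)) (Finset (Fin n)) ℤ),
      kroneckerMap (· * ·) A ((-B).map (Int.castRingHom R)) =
        -kroneckerMap (· * ·) A (B.map (Int.castRingHom R)) := by
    intro A B
    ext
    simp [kroneckerMap_apply]
  simp only [koszulMatrix, Finset.sum_mul_sum, h1]
  rw [← Finset.sum_product']
  refine Finset.sum_involution (fun p _ => p.swap) ?_ ?_ (by simp) (by simp)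
  · rintro ⟨i, j⟩ -
    simp only [Prod.swap]
    rw [hf j i, contraction_mul_contraction j i, h2, add_neg_cancel]
  · rintro ⟨i, j⟩ - hne heq
    obtain rfl : j = i := congrArg Prod.fst heq
    refine hne ?_
    have : contraction j * contraction j = 0 := by
      ext S T
      rw [contraction_mul_apply]
      split_ifs <;> simp [contraction]
    rw [this]
    ext
    simp [kroneckerMap_apply]

lemma transpose_koszulMatrix_mul (f : Fin n → Matrix α α R) (T : Matrix α α R)
    (hT : ∀ l, (f l)ᵀ * T = T * f l) :
    (koszulMatrix f)ᵀ * kroneckerMap (· * ·) T ((koszulForm n).map (Int.castRingHom R)) =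
      kroneckerMap (· * ·) T ((koszulForm n).map (Int.castRingHom R)) * koszulMatrix f := by
  rw [koszulMatrix, transpose_sum, Finset.sum_mul, Finset.mul_sum]
  refine Finset.sum_congr rfl fun l _ => ?_
  rw [← kroneckerMap_transpose, ← mul_kronecker_mul, ← mul_kronecker_mul, hT, ← transpose_map,
    ← Matrix.map_mul, transpose_contraction_mul_koszulForm, Matrix.map_mul]

/-- Square matrices as endomorphisms over a smaller ring of scalars. -/
def mulVecEnd [DecidableEq α] (A : Type*) [CommRing A] [Algebra A R] : Matrix α α R →+* Module.End A (α → R) where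
  toFun B := (Matrix.mulVecLin B).restrictScalars A
  map_one' := by ext; simp
  map_mul' B C := by ext; simp
  map_zero' := by ext; simp
  map_add' B C := by ext; simp

lemma mulVecEnd_apply [DecidableEq α] (A : Type*) [CommRing A] [Algebra A R] (B : Matrix α α R) (v : α → R) :
    mulVecEnd A B v = B *ᵥ v := rfl

/-- This passes to endomorphisms over the smaller ring `A`, needed because the homotopies used for
exactness are linear over `k` but not over the polynomial ring. -/
lemma koszulMatrix_mulVec [DecidableEq α] (A : Type*) [CommRing A] [Algebra A R] (f : Fin n → Matrix α α R)
    (z : Finset (Fin n) → α → R) :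
    koszulMatrix f *ᵥ (fun p => z p.2 p.1) =
      fun p => koszulEnd (fun l => mulVecEnd A (f l)) z p.2 p.1 := by
  ext ⟨a, S⟩
  rw [koszulMatrix, sum_mulVec, Finset.sum_apply, koszulEnd, LinearMap.sum_apply, Finset.sum_apply,
    Finset.sum_apply]
  refine Finset.sum_congr rfl fun l _ => ?_
  rw [tensorEnd_apply, Finset.sum_apply, Matrix.mulVec, dotProduct, Fintype.sum_prod_type,
    Finset.sum_comm]
  refine Finset.sum_congr rfl fun T _ => ?_
  rw [Pi.smul_apply, mulVecEnd_apply, Matrix.mulVec, dotProduct, zsmul_eq_mul, Finset.mul_sum]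
  exact Finset.sum_congr rfl fun b _ => by
    simp only [kroneckerMap_apply, Matrix.map_apply, eq_intCast]
    ring

end KoszulMatrix

/-! ### The Koszul resolution of a finite-dimensional module -/

section MultiplicationMatrices

variable {k : Type*} [Field k] {n : ℕ} {α : Type*} [Fintype α]

/-- The division by a variable, with remainder independent of this variable. -/
noncomputable def divVar (j : Fin n) :
    MvPolynomial (Fin n) k →ₗ[k] MvPolynomial (Fin n) k where
  toFun p := p.divMonomial (Finsupp.single j 1)
  map_add' p q := add_divMonomial p q _
  map_smul' c p := by
    ext m
    simp [coeff_divMonomial]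

lemma divVar_X_mul_self (j : Fin n) (p : MvPolynomial (Fin n) k) : divVar j (X j * p) = p :=
  X_mul_divMonomial j p

lemma divVar_X_mul {i j : Fin n} (h : i ≠ j) (p : MvPolynomial (Fin n) k) :
    divVar j (X i * p) = X i * divVar j p := by
  ext m
  change coeff m ((X i * p).divMonomial _) = coeff m (X i * p.divMonomial _)
  rw [coeff_divMonomial, coeff_X_mul', coeff_X_mul', coeff_divMonomial]
  have h1 : ((Finsupp.single j 1 + m : Fin n →₀ ℕ) i) = m i := by simp [h]
  by_cases hi : m i = 0
  · rw [if_neg (by rw [Finsupp.mem_support_iff, h1, hi]; simp),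
      if_neg (by rw [Finsupp.mem_support_iff, hi]; simp)]
  · rw [if_pos (by rwa [Finsupp.mem_support_iff, h1]),
      if_pos (by rwa [Finsupp.mem_support_iff])]
    congr 1
    ext t
    rcases eq_or_ne t i with rfl | ht
    · simp [h]
    · simp [ht.symm]

/-- The matrices of multiplication with `x_l ⊗ 1 - 1 ⊗ x_l` on `R ⊗ M`, where `x` are the
matrices of multiplication with the variables on `M`. -/
noncomputable def diagonalMatrix [DecidableEq α] (x : Fin n → Matrix α α k) (l : Fin n) :
    Matrix α α (MvPolynomial (Fin n) k) :=
  (X l : MvPolynomial (Fin n) k) • (1 : Matrix α α (MvPolynomial (Fin n) k)) - (x l).map C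

lemma diagonalMatrix_comm [DecidableEq α] {x : Fin n → Matrix α α k} (hx : ∀ i j, x i * x j = x j * x i)
    (i j : Fin n) :
    diagonalMatrix x i * diagonalMatrix x j = diagonalMatrix x j * diagonalMatrix x i := by
  have h : (x i).map (C : k →+* MvPolynomial (Fin n) k) * (x j).map C =
      (x j).map C * (x i).map C := by rw [← Matrix.map_mul, hx, Matrix.map_mul]
  simp only [diagonalMatrix, sub_mul, mul_sub, h, smul_mul_assoc, mul_smul_comm, one_mul, mul_one,
    smul_sub, smul_comm (X i : MvPolynomial (Fin n) k) (X j : MvPolynomial (Fin n) k)]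
  abel

/-- Division by `X j` is a `k`-linear left inverse `G` of multiplication by `X j`, and it commutes
with the other variables and with constant matrices. Hence `G * (X j - x j) = 1 - G * x j`, which is
invertible since `x j` is nilpotent, and the inverse times `G` is the required map. -/
lemma exists_leftInverse_diagonalMatrix [DecidableEq α] {x : Fin n → Matrix α α k}
    (hx : ∀ i j, x i * x j = x j * x i) (hnil : ∀ l, IsNilpotent (x l)) :
    ∃ h : Fin n → Module.End k (α → MvPolynomial (Fin n) k),
      (∀ j, h j * mulVecEnd k (diagonalMatrix x j) = 1) ∧
      ∀ i j, i ≠ j → h j * mulVecEnd k (diagonalMatrix x i) =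
        mulVecEnd k (diagonalMatrix x i) * h j := by
  let G : Fin n → Module.End k (α → MvPolynomial (Fin n) k) := fun j => (divVar j).compLeft α
  let Y : Fin n → Module.End k (α → MvPolynomial (Fin n) k) := fun j =>
    mulVecEnd k ((X j : MvPolynomial (Fin n) k) • (1 : Matrix α α (MvPolynomial (Fin n) k)))
  let x' : Fin n → Module.End k (α → MvPolynomial (Fin n) k) := fun j =>
    mulVecEnd k ((x j).map C)
  have hY : ∀ j v a, Y j v a = X j * v a := fun j v a => by
    simp [Y, mulVecEnd_apply, Matrix.smul_mulVec]
  have hf : ∀ j, mulVecEnd k (diagonalMatrix x j) = Y j - x' j := fun j => map_sub _ _ _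
  have hGY : ∀ j, G j * Y j = 1 := fun j => LinearMap.ext fun v => funext fun a => by
    rw [Module.End.mul_apply]
    change divVar j (Y j v a) = v a
    rw [hY, divVar_X_mul_self]
  have hGY' : ∀ i j, i ≠ j → Commute (G j) (Y i) := fun i j hij =>
    LinearMap.ext fun v => funext fun a => by
      rw [Module.End.mul_apply, Module.End.mul_apply, hY]
      change divVar j (Y i v a) = X i * divVar j (v a)
      rw [hY, divVar_X_mul hij]
  have hGx : ∀ i j, Commute (G j) (x' i) := fun i j =>
    LinearMap.ext fun v => funext fun a => by
      change divVar j (∑ b, C (x i a b) * v b) = ∑ b, C (x i a b) * divVar j (v b)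
      rw [map_sum]
      exact Finset.sum_congr rfl fun b _ => by rw [← smul_eq_C_mul, map_smul, smul_eq_C_mul]
  have hxx : ∀ i j, Commute (x' i) (x' j) := fun i j => by
    change mulVecEnd k _ * mulVecEnd k _ = _
    rw [← map_mul, ← Matrix.map_mul, hx, Matrix.map_mul, map_mul]
  have hxY : ∀ i j, Commute (x' i) (Y j) := fun i j => by
    change mulVecEnd k _ * mulVecEnd k _ = _
    rw [← map_mul, mul_smul_comm, mul_one, ← map_mul, smul_mul_assoc, one_mul]
  have hxnil : ∀ j, IsNilpotent (x' j) := fun j =>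
    ((hnil j).map (C : k →+* MvPolynomial (Fin n) k).mapMatrix).map (mulVecEnd k)
  have hu : ∀ j, IsUnit (1 - G j * x' j) := fun j =>
    ((hGx j j).isNilpotent_mul_left (hxnil j)).isUnit_one_sub
  choose u hu using hu
  refine ⟨fun j => ↑(u j)⁻¹ * G j, fun j => ?_, fun i j hij => ?_⟩
  · rw [hf, mul_assoc, mul_sub, hGY, ← hu, Units.inv_mul]
  · have h1 : Commute (G j) (mulVecEnd k (diagonalMatrix x i)) := by
      rw [hf]
      exact (hGY' i j hij).sub_right (hGx i j)
    have h2 : Commute (x' j) (mulVecEnd k (diagonalMatrix x i)) := by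
      rw [hf]
      exact (hxY j i).sub_right (hxx j i)
    have h3 : Commute (u j : Module.End k (α → MvPolynomial (Fin n) k))
        (mulVecEnd k (diagonalMatrix x i)) := by
      rw [hu]
      exact (Commute.one_left _).sub_left (h1.mul_left h2)
    exact (h3.units_inv_left.mul_left h1).eq

variable {M : Type*} [AddCommGroup M] [Module k M] [Module (MvPolynomial (Fin n) k) M]
  (b : Module.Basis α k M)

/-- The matrix of multiplication with a variable. -/
noncomputable def varMatrix (l : Fin n) : Matrix α α k :=
  Matrix.of fun a a' => b.repr ((X l : MvPolynomial (Fin n) k) • b a') a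

lemma sum_varMatrix_smul (l : Fin n) (a' : α) :
    ∑ a, varMatrix b l a a' • b a = (X l : MvPolynomial (Fin n) k) • b a' :=
  b.sum_repr _

lemma varMatrix_comm [IsScalarTower k (MvPolynomial (Fin n) k) M] (i j : Fin n) :
    varMatrix b i * varMatrix b j = varMatrix b j * varMatrix b i := by
  have h : ∀ i j : Fin n, ∀ a', ∑ a, (varMatrix b i * varMatrix b j) a a' • b a =
      (X i * X j : MvPolynomial (Fin n) k) • b a' := by
    intro i j a'
    rw [mul_smul, ← sum_varMatrix_smul b j, Finset.smul_sum]
    simp only [Matrix.mul_apply, Finset.sum_smul]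
    rw [Finset.sum_comm]
    refine Finset.sum_congr rfl fun y _ => ?_
    rw [smul_comm (X i : MvPolynomial (Fin n) k), ← sum_varMatrix_smul b i, Finset.smul_sum]
    exact Finset.sum_congr rfl fun a _ => by rw [smul_smul, mul_comm]
  have h' : ∀ i j : Fin n, ∀ a a', (varMatrix b i * varMatrix b j) a a' =
      b.repr ((X i * X j : MvPolynomial (Fin n) k) • b a') a := by
    intro i j a a'
    rw [← h, b.repr_sum_self]
  ext a a'
  rw [h', h', mul_comm]

/-- The augmentation `R ⊗ M → M`. -/
noncomputable def baseAug :
    (α → MvPolynomial (Fin n) k) →ₗ[MvPolynomial (Fin n) k] M :=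
  Fintype.linearCombination _ b

lemma baseAug_apply (z : α → MvPolynomial (Fin n) k) : baseAug b z = ∑ a, z a • b a := rfl

lemma baseAug_diagonalMatrix [DecidableEq α] [IsScalarTower k (MvPolynomial (Fin n) k) M]
    (l : Fin n) (v : α → MvPolynomial (Fin n) k) :
    baseAug b (diagonalMatrix (varMatrix b) l *ᵥ v) = 0 := by
  have h : baseAug b ∘ₗ (diagonalMatrix (varMatrix b) l).mulVecLin = 0 := by
    ext a'
    simp only [LinearMap.comp_apply, LinearMap.coe_single, Matrix.mulVecLin_apply,
      Matrix.mulVec_single_one, baseAug_apply, Matrix.col_apply, diagonalMatrix, Matrix.sub_apply,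
      Matrix.smul_apply, Matrix.one_apply, Matrix.map_apply, sub_smul, Finset.sum_sub_distrib,
      LinearMap.zero_apply, smul_eq_mul, mul_ite, mul_one, mul_zero, ite_smul, zero_smul,
      Finset.sum_ite_eq', Finset.mem_univ, if_true]
    rw [← sum_varMatrix_smul b l a', sub_eq_zero]
    exact Finset.sum_congr rfl fun a _ => by
      rw [← algebraMap_eq, algebraMap_smul]
  exact LinearMap.congr_fun h v

/-- Modulo the images of the diagonal matrices, a variable may be replaced by its action on `M`, so
every vector is congruent to a constant one. On constant vectors the augmentation is injective. -/
lemma exists_eq_sum_diagonalMatrix [DecidableEq α] [IsScalarTower k (MvPolynomial (Fin n) k) M]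
    {z : α → MvPolynomial (Fin n) k} (hz : baseAug b z = 0) :
    ∃ v : Fin n → α → MvPolynomial (Fin n) k,
      z = ∑ l, diagonalMatrix (varMatrix b) l *ᵥ v l := by
  let W : Submodule (MvPolynomial (Fin n) k) (α → MvPolynomial (Fin n) k) :=
    LinearMap.range (LinearMap.lsum (MvPolynomial (Fin n) k)
      (fun _ : Fin n => α → MvPolynomial (Fin n) k) ℕ
      (fun l => (diagonalMatrix (varMatrix b) l).mulVecLin))
  have hW : ∀ l v, diagonalMatrix (varMatrix b) l *ᵥ v ∈ W := fun l v =>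
    ⟨Pi.single l v, by simp [LinearMap.lsum_apply, Pi.single_apply, apply_ite]⟩
  let ι : (α → k) → α → MvPolynomial (Fin n) k := fun c a => C (c a)
  have key : ∀ (r : MvPolynomial (Fin n) k) (c : α → k), ∃ c', r • ι c - ι c' ∈ W := by
    intro r
    induction r using MvPolynomial.induction_on with
    | C a =>
      intro c
      refine ⟨a • c, ?_⟩
      have : (C a : MvPolynomial (Fin n) k) • ι c - ι (a • c) = 0 := by
        ext1 y
        simp [ι]
      rw [this]
      exact W.zero_mem
    | add p q hp hq =>
      intro c
      obtain ⟨c1, h1⟩ := hp c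
      obtain ⟨c2, h2⟩ := hq c
      refine ⟨c1 + c2, ?_⟩
      have : (p + q) • ι c - ι (c1 + c2) = (p • ι c - ι c1) + (q • ι c - ι c2) := by
        ext1 y
        simp [ι]
        ring
      rw [this]
      exact W.add_mem h1 h2
    | mul_X p l hp =>
      intro c
      obtain ⟨c1, h1⟩ := hp (varMatrix b l *ᵥ c)
      refine ⟨c1, ?_⟩
      have h2 : diagonalMatrix (varMatrix b) l *ᵥ ι c =
          (X l : MvPolynomial (Fin n) k) • ι c - ι (varMatrix b l *ᵥ c) := by
        ext1 y
        simp [diagonalMatrix, ι, Matrix.mulVec, dotProduct, sub_mul, Matrix.one_apply]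
      have : (p * X l) • ι c - ι c1 = p • (diagonalMatrix (varMatrix b) l *ᵥ ι c) +
          (p • ι (varMatrix b l *ᵥ c) - ι c1) := by
        rw [h2, smul_sub, mul_smul]
        abel
      rw [this]
      exact W.add_mem (W.smul_mem _ (hW _ _)) h1
  choose c' hc' using fun a : α => key (z a) (Pi.single a 1)
  have h1 : z - ι (∑ a, c' a) ∈ W := by
    have : z - ι (∑ a, c' a) = ∑ a, (z a • ι (Pi.single a 1) - ι (c' a)) := by
      ext1 y
      simp [ι, Finset.sum_sub_distrib, Pi.single_apply, apply_ite]
    rw [this]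
    exact W.sum_mem fun a _ => hc' a
  have hW0 : ∀ y ∈ W, baseAug b y = 0 := by
    rintro _ ⟨v, rfl⟩
    simp [LinearMap.lsum_apply, baseAug_diagonalMatrix]
  have h2 := hW0 _ h1
  rw [map_sub, hz, zero_sub, neg_eq_zero, baseAug_apply] at h2
  have h3 : ∑ a, (∑ a', c' a') a • b a = 0 := by
    rw [← h2]
    exact Finset.sum_congr rfl fun a _ => by
      simp only [ι]
      rw [← algebraMap_eq, algebraMap_smul]
  have h4 := Fintype.linearIndependent_iff.mp b.linearIndependent _ h3
  have h5 : ι (∑ a, c' a) = 0 := by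
    ext1 y
    simp only [ι, h4, map_zero, Pi.zero_apply]
  rw [h5, sub_zero] at h1
  obtain ⟨v, hv⟩ := h1
  refine ⟨v, ?_⟩
  rw [← hv]
  simp [LinearMap.lsum_apply]

/-- Exactness of the Koszul resolution of a module on which the variables act nilpotently. -/
theorem exists_koszulMatrix_mulVec_eq [DecidableEq α] [IsScalarTower k (MvPolynomial (Fin n) k) M]
    (hnil : ∀ l : Fin n, IsNilpotent (varMatrix b l))
    {z : α × Finset (Fin n) → MvPolynomial (Fin n) k}
    (hz : koszulMatrix (diagonalMatrix (varMatrix b)) *ᵥ z = 0)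
    (hz0 : baseAug b (fun a => z (a, ∅)) = 0) :
    ∃ w, koszulMatrix (diagonalMatrix (varMatrix b)) *ᵥ w = z := by
  obtain ⟨h, h1, h2⟩ := exists_leftInverse_diagonalMatrix (varMatrix_comm (n := n) b) hnil
  have hDD := koszulMatrix_mul_self _ (diagonalMatrix_comm (varMatrix_comm (n := n) b))
  have key := koszulMatrix_mulVec k (diagonalMatrix (n := n) (varMatrix b))
  have h4 : ∃ w, koszulEnd (fun l => mulVecEnd k (diagonalMatrix (varMatrix b) l)) w =
      fun S a => z (a, S) := by
    refine exists_koszulEnd_eq _ h h1 h2 ?_ ?_ ?_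
    · refine LinearMap.ext fun v => funext fun S => funext fun a => ?_
      have h3 := congrArg (fun B => B *ᵥ (fun p : α × Finset (Fin n) => v p.2 p.1)) hDD
      simp only [← Matrix.mulVec_mulVec, key, Matrix.zero_mulVec] at h3
      exact congrFun h3 (a, S)
    · have h3 := key (fun S a => z (a, S))
      funext S a
      exact (congrFun h3 (a, S)).symm.trans (congrFun hz (a, S))
    · exact exists_eq_sum_diagonalMatrix b hz0
  obtain ⟨w, hw⟩ := h4
  exact ⟨fun p => w p.2 p.1, by rw [key, hw]⟩

end MultiplicationMatrices
-- Blocks of matrices and coordinates on dual modules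
section Blocks

variable {R κ A B C : Type*} [CommRing R] [Fintype κ] [Fintype A]

lemma submatrix_mulVec_eq_extend (X : Matrix κ κ R) {u : A → κ} (hu : Function.Injective u)
    (v : B → κ) (x : A → R) (b : B) :
    (X.submatrix v u *ᵥ x) b = (X *ᵥ Function.extend u x 0) (v b) := by
  refine Fintype.sum_of_injective u hu _ _ (fun t ht => ?_) (fun a => ?_)
  · rw [Function.extend_apply' _ _ _ (by simpa using ht), Pi.zero_apply, mul_zero]
  · change X (v b) (u a) * x a = X (v b) (u a) * _
    rw [hu.extend_apply]

lemma submatrix_mulVec_comp (X : Matrix κ κ R) {u : A → κ} (hu : Function.Injective u)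
    {v : B → κ} (hX : ∀ s t, X (v s) t ≠ 0 → t ∈ Set.range u) (z : κ → R) :
    X.submatrix v u *ᵥ (z ∘ u) = (X *ᵥ z) ∘ v := by
  funext b
  refine Fintype.sum_of_injective u hu _ _ (fun t ht => ?_) (fun a => rfl)
  exact mul_eq_zero_of_left (by_contra fun h => ht (hX b t h)) _

lemma mulVec_extend_eq_zero (X : Matrix κ κ R) {u : A → κ} (hu : Function.Injective u)
    {v : B → κ} (hX : ∀ s t, X s (u t) ≠ 0 → s ∈ Set.range v) {x : A → R}
    (hx : X.submatrix v u *ᵥ x = 0) : X *ᵥ Function.extend u x 0 = 0 := by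
  funext s
  by_cases hs : s ∈ Set.range v
  · obtain ⟨b, rfl⟩ := hs
    rw [← submatrix_mulVec_eq_extend X hu v x b, hx, Pi.zero_apply, Pi.zero_apply]
  · refine Finset.sum_eq_zero fun t _ => ?_
    by_cases ht : t ∈ Set.range u
    · obtain ⟨a, rfl⟩ := ht
      exact mul_eq_zero_of_left (by_contra fun h => hs (hX s a h)) _
    · rw [Function.extend_apply' _ _ _ (by simpa using ht), Pi.zero_apply, mul_zero]

/-- Exactness of two matrices implies the exactness of their blocks. -/
lemma exact_submatrix [Fintype B] {X Y : Matrix κ κ R} {u : A → κ} {v : B → κ} {w : C → κ}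
    (hu : Function.Injective u) (hv : Function.Injective v) (hYX : Y * X = 0)
    (hX : ∀ s t, X (v s) t ≠ 0 → t ∈ Set.range u) (hX' : ∀ s t, X s (u t) ≠ 0 → s ∈ Set.range v)
    (hY : ∀ s t, Y s (v t) ≠ 0 → s ∈ Set.range w)
    (hex : ∀ z, Y *ᵥ z = 0 → (∀ s, z s ≠ 0 → s ∈ Set.range v) → ∃ y, X *ᵥ y = z) :
    Function.Exact (X.submatrix v u).mulVecLin (Y.submatrix w v).mulVecLin := by
  intro y
  simp only [Matrix.mulVecLin_apply, Set.mem_range]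
  constructor
  · intro hy
    have h1 := mulVec_extend_eq_zero Y hv hY hy
    obtain ⟨z, hz⟩ := hex _ h1 fun s hs => by
      by_contra h
      exact hs (by rw [Function.extend_apply' _ _ _ (by simpa using h), Pi.zero_apply])
    refine ⟨z ∘ u, ?_⟩
    rw [submatrix_mulVec_comp X hu hX, hz]
    funext b
    rw [Function.comp_apply, hv.extend_apply]
  · rintro ⟨x, rfl⟩
    rw [Matrix.mulVec_mulVec]
    have : Y.submatrix w v * X.submatrix v u = (Y * X).submatrix w u := by
      ext c a
      refine Fintype.sum_of_injective v hv _ _ (fun t ht => ?_) (fun b => rfl)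
      exact mul_eq_zero_of_right _ (by_contra fun h => ht (hX' t a h))
    rw [this, hYX]
    funext c
    simp [Matrix.mulVec, dotProduct]

/-- The coordinates of functionals with respect to the dual of the standard basis. -/
noncomputable def dualCoord (R A : Type*) [CommRing R] [Fintype A] [DecidableEq A] :
    Module.Dual R (A → R) ≃ₗ[R] (A → R) :=
  (Pi.basisFun R A).dualBasis.equivFun

/-- A vector whose coordinates lie in an ideal lies in the product with the ideal. -/
lemma mem_smul_top_of_forall_repr {F : Type*} [AddCommGroup F] [Module R F]
    (b : Module.Basis A R F) (I : Ideal R) {x : F} (hx : ∀ a, b.repr x a ∈ I) :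
    x ∈ I • (⊤ : Submodule R F) := by
  rw [← b.sum_repr x]
  exact Submodule.sum_mem _ fun a _ => Submodule.smul_mem_smul (hx a) trivial

variable [DecidableEq A] [Fintype B] [DecidableEq B]

lemma dualCoord_apply (φ : Module.Dual R (A → R)) (a : A) :
    dualCoord R A φ a = φ (Pi.single a 1) := by
  simp [dualCoord, Module.Basis.equivFun_apply]

lemma dual_apply_eq_dotProduct (φ : Module.Dual R (A → R)) (v : A → R) :
    φ v = dualCoord R A φ ⬝ᵥ v := by
  conv_lhs => rw [← Finset.univ_sum_single v, map_sum]
  refine Finset.sum_congr rfl fun a _ => ?_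
  have h : (Pi.single a (v a) : A → R) = v a • Pi.single a 1 := by
    rw [← Pi.single_smul, smul_eq_mul, mul_one]
  rw [dualCoord_apply, h, map_smul, smul_eq_mul, mul_comm]

lemma dualCoord_dualMap (X : Matrix A B R) (φ : Module.Dual R (A → R)) :
    dualCoord R B (X.mulVecLin.dualMap φ) = Xᵀ *ᵥ dualCoord R A φ := by
  funext b
  rw [dualCoord_apply, LinearMap.dualMap_apply, dual_apply_eq_dotProduct, Matrix.mulVecLin_apply,
    Matrix.mulVec_single_one, Matrix.mulVec, dotProduct_comm]
  rfl

end Blocks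

/-! ### Homogeneity and minimality of maps given by matrices -/

section Homogeneous

variable {k : Type*} [Field k] {n : ℕ} {d : Fin n → ℤ}

lemma isHomogeneousMap_mulVecLin {A B : Type*} [Fintype B] {eA : A → ℤ} {eB : B → ℤ}
    {X : Matrix A B (MvPolynomial (Fin n) k)}
    (hX : ∀ a b, IsWeightedHomogeneous d (X a b) (eB b - eA a)) :
    IsHomogeneousMap (freeGrading (k := k) d eB) (freeGrading d eA) X.mulVecLin := by
  intro j x hx a
  rw [Matrix.mulVecLin_apply, Matrix.mulVec, dotProduct]
  refine Submodule.sum_mem _ fun b _ => ?_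
  have h := (hX a b).mul (hx b)
  rwa [show eB b - eA a + (j - eB b) = j - eA a by abel] at h

lemma mem_span_X_of_constantCoeff_eq_zero {p : MvPolynomial (Fin n) k}
    (hp : constantCoeff p = 0) :
    p ∈ Ideal.span (Set.range (X : Fin n → MvPolynomial (Fin n) k)) := by
  rw [← Set.image_univ, mem_ideal_span_X_image]
  intro m hm
  by_contra! h
  have : m = 0 := by
    ext i
    exact h i (Set.mem_univ i)
  rw [this, mem_support_iff] at hm
  exact hm hp

lemma isMinimalMap_of_forall_repr {A F G : Type*} [Fintype A] [AddCommGroup F]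
    [Module (MvPolynomial (Fin n) k) F] [AddCommGroup G] [Module (MvPolynomial (Fin n) k) G]
    (b : Module.Basis A (MvPolynomial (Fin n) k) G) (f : F →ₗ[MvPolynomial (Fin n) k] G)
    (hf : ∀ x a, constantCoeff (b.repr (f x) a) = 0) : IsMinimalMap f := by
  rintro _ ⟨x, rfl⟩
  exact mem_smul_top_of_forall_repr b _ fun a => mem_span_X_of_constantCoeff_eq_zero (hf x a)

lemma isMinimalMap_mulVecLin {A B : Type*} [Fintype A] [Fintype B]
    {Y : Matrix A B (MvPolynomial (Fin n) k)} (hY : ∀ a b, constantCoeff (Y a b) = 0) :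
    IsMinimalMap Y.mulVecLin := by
  classical
  refine isMinimalMap_of_forall_repr (Pi.basisFun _ _) _ fun x a => ?_
  simp [Matrix.mulVec, dotProduct, hY]

lemma isMinimalMap_dualMap_mulVecLin {A B : Type*} [Fintype A] [Fintype B]
    {Y : Matrix A B (MvPolynomial (Fin n) k)} (hY : ∀ a b, constantCoeff (Y a b) = 0) :
    IsMinimalMap Y.mulVecLin.dualMap := by
  classical
  refine isMinimalMap_of_forall_repr (Pi.basisFun _ _).dualBasis _ fun x b => ?_
  have h : (Pi.basisFun (MvPolynomial (Fin n) k) B).dualBasis.repr (Y.mulVecLin.dualMap x) b =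
      (Yᵀ *ᵥ dualCoord _ A x) b := by rw [← dualCoord_dualMap]; rfl
  rw [h]
  simp [Matrix.mulVec, dotProduct, hY]

end Homogeneous
/-- The matrix of a (skew) symmetric map from the dual of a free module to the module. -/
lemma transpose_toMatrix_dualBasis {R F A : Type*} [CommRing R] [AddCommGroup F] [Module R F]
    [Fintype A] [DecidableEq A] (b : Module.Basis A R F) (f : Module.Dual R F →ₗ[R] F) {σ : ℤ}
    (hf : ∀ φ χ : Module.Dual R F, φ (f χ) = σ • χ (f φ)) :
    (LinearMap.toMatrix b.dualBasis b f)ᵀ = σ • LinearMap.toMatrix b.dualBasis b f := by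
  ext i j
  rw [Matrix.transpose_apply, Matrix.smul_apply, LinearMap.toMatrix_apply,
    LinearMap.toMatrix_apply, ← Module.Basis.coord_apply, ← Module.Basis.coord_apply,
    Module.Basis.coe_dualBasis, hf]

/-! ### The selfdual resolution from a selfadjoint minimal differential -/

section Assembly

variable {k : Type*} [Field k] {n : ℕ} {d : Fin n → ℤ} {M : Type*} [AddCommGroup M] [Module k M]
  [Module (MvPolynomial (Fin n) k) M] {𝓜 : ℤ → Submodule k M}
  [SetLike.GradedSMul (MvPolynomial.weightedHomogeneousSubmodule k d) 𝓜]
  {κ : Type*} [Fintype κ] [DecidableEq κ]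

/-- A minimal complex with a selfadjoint differential `D`, whose only homology is the cokernel
`M` of the differential, yields a selfdual minimal resolution of `M`. -/
theorem exists_selfdualResolution {m : ℕ} (hm : 1 ≤ m) {s : ℤ} {σ : ℤ} {q e : κ → ℤ}
    (hq : ∀ a, 0 ≤ q a) {D J K : Matrix κ κ (MvPolynomial (Fin n) k)}
    (hDq : ∀ a b, D a b ≠ 0 → q b = q a + 1)
    (hDe : ∀ a b, IsWeightedHomogeneous d (D a b) (e b - e a))
    (hKq : ∀ a b, K a b ≠ 0 → q a + q b = 2 * m + 1)
    (hKe : ∀ a b, IsWeightedHomogeneous d (K a b) (∑ l, d l + s - e b - e a))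
    (hD0 : ∀ a b, constantCoeff (D a b) = 0) (hDJ : Dᵀ * J = J * D) (hJK : J * K = 1)
    (hKt : Kᵀ = σ • K) (hDD : D * D = 0)
    {aug : (κ → MvPolynomial (Fin n) k) →ₗ[MvPolynomial (Fin n) k] M}
    (haug0 : ∀ a, q a ≠ 0 → aug (Pi.single a 1) = 0) (haug : ∀ a, aug (Pi.single a 1) ∈ 𝓜 (e a))
    (haugD : ∀ y, aug (D *ᵥ y) = 0) (haug_surj : Function.Surjective aug)
    (hex : ∀ z, D *ᵥ z = 0 → aug z = 0 → ∃ y, D *ᵥ y = z) :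
    ∃ F : SelfdualResolution d 𝓜 m s, F.IsMinimal ∧
      ∀ b : Module.Basis (Fin (F.rank m)) (MvPolynomial (Fin n) k)
          (Fin (F.rank m) → MvPolynomial (Fin n) k),
        (LinearMap.toMatrix b.dualBasis b F.mid)ᵀ =
          σ • LinearMap.toMatrix b.dualBasis b F.mid := by
  classical
  let rank : ℕ → ℕ := fun i => Fintype.card {a : κ // q a = i}
  let en : ∀ i : ℕ, Fin (rank i) → κ := fun i t =>
    ((Fintype.equivFin {a : κ // q a = i}).symm t).1
  have hen : ∀ i t, q (en i t) = i := fun i t =>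
    ((Fintype.equivFin {a : κ // q a = i}).symm t).2
  have hinj : ∀ i, Function.Injective (en i) := fun i =>
    Subtype.val_injective.comp (Equiv.injective _)
  have hrange : ∀ i a, q a = (i : ℕ) → a ∈ Set.range (en i) := fun i a ha =>
    ⟨Fintype.equivFin {a : κ // q a = i} ⟨a, ha⟩, by simp [en]⟩
  have hrange' : ∀ (i : ℕ) a, a ∈ Set.range (en i) → q a = i := by
    rintro i _ ⟨t, rfl⟩
    exact hen i t
  have hKJ : K * J = 1 := mul_eq_one_comm.mp hJK
  -- The form identifies the dual complex with the complex itself; every statement about transposes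
  -- below is derived from this.
  have hDt : Dᵀ = J * D * K := by
    rw [← hDJ, Matrix.mul_assoc, hJK, Matrix.mul_one]
  have hDtDt : Dᵀ * Dᵀ = 0 := by rw [← transpose_mul, hDD, transpose_zero]
  have hDKt : (D * K)ᵀ = σ • (D * K) := by
    rw [transpose_mul, hKt, Matrix.smul_mul, hDt, ← Matrix.mul_assoc, ← Matrix.mul_assoc, hKJ,
      Matrix.one_mul]
  have hDKq : ∀ a b, (D * K) a b ≠ 0 → q a + q b = 2 * m := by
    intro a b h
    obtain ⟨c, -, hc⟩ := Finset.exists_ne_zero_of_sum_ne_zero h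
    have h1 := hDq a c (left_ne_zero_of_mul hc)
    have h2 := hKq c b (right_ne_zero_of_mul hc)
    omega
  have hDKe : ∀ a b, IsWeightedHomogeneous d ((D * K) a b) (∑ l, d l + s - e b - e a) := by
    intro a b
    refine IsWeightedHomogeneous.sum _ _ _ fun c _ => ?_
    have := (hDe a c).mul (hKe c b)
    rwa [show e c - e a + (∑ l, d l + s - e b - e c) = ∑ l, d l + s - e b - e a by abel] at this
  have hDK0 : ∀ a b, constantCoeff ((D * K) a b) = 0 := by
    intro a b
    simp [Matrix.mul_apply, hD0]
  have aug_eq : ∀ z, aug z = ∑ t, z (en 0 t) • aug (Pi.single (en 0 t) 1) := by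
    intro z
    have h1 : aug z = ∑ a, z a • aug (Pi.single a 1) := by
      conv_lhs => rw [← Finset.univ_sum_single z, map_sum]
      refine Finset.sum_congr rfl fun a _ => ?_
      rw [← map_smul, ← Pi.single_smul, smul_eq_mul, mul_one]
    rw [h1]
    refine (Fintype.sum_of_injective (en 0) (hinj 0) _ _ (fun a ha => ?_) fun t => rfl).symm
    rw [haug0 a fun h => ha (hrange 0 a h), smul_zero]
  -- exactness of the dual complex
  have hexK : ∀ z, D *ᵥ (K *ᵥ z) = 0 → (∀ a, z a ≠ 0 → q a ≠ 2 * m + 1) →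
      ∃ y, Dᵀ *ᵥ y = z := by
    intro z hz hz0
    -- `K` pairs homological degrees `i` and `2m + 1 - i`, so without a component in degree `2m + 1`
    -- the vector `z` goes to one without a component in degree 0, where the only homology lies.
    have h1 : aug (K *ᵥ z) = 0 := by
      rw [aug_eq]
      refine Finset.sum_eq_zero fun t _ => ?_
      have : (K *ᵥ z) (en 0 t) = 0 := by
        refine Finset.sum_eq_zero fun b _ => ?_
        by_contra h
        have h2 := hKq _ b (left_ne_zero_of_mul h)
        rw [hen, Nat.cast_zero, zero_add] at h2
        exact hz0 b (right_ne_zero_of_mul h) h2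
      rw [this, zero_smul]
    obtain ⟨y, hy⟩ := hex _ hz h1
    refine ⟨J *ᵥ y, ?_⟩
    rw [Matrix.mulVec_mulVec, hDJ, ← Matrix.mulVec_mulVec, hy, Matrix.mulVec_mulVec, hJK,
      Matrix.one_mulVec]
  have hexDt : ∀ z, Dᵀ *ᵥ z = 0 → (∀ a, z a ≠ 0 → q a ≠ 2 * m + 1) → ∃ y, Dᵀ *ᵥ y = z := by
    intro z hz hz0
    refine hexK z ?_ hz0
    have h1 := congrArg (fun v => K *ᵥ v) hz
    simpa only [hDt, Matrix.mulVec_mulVec, ← Matrix.mul_assoc, hKJ, Matrix.one_mul,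
      Matrix.mulVec_zero] using h1
  let ψ : ∀ i : ℕ, (Fin (rank i) → MvPolynomial (Fin n) k) →ₗ[MvPolynomial (Fin n) k]
      (Fin (rank (i - 1)) → MvPolynomial (Fin n) k) :=
    fun i => (D.submatrix (en (i - 1)) (en i)).mulVecLin
  let aug' : (Fin (rank 0) → MvPolynomial (Fin n) k) →ₗ[MvPolynomial (Fin n) k] M :=
    Fintype.linearCombination _ fun t => aug (Pi.single (en 0 t) 1)
  have haug' : ∀ z, aug' (z ∘ en 0) = aug z := fun z => (aug_eq z).symm
  -- The block of `D` from degree `m + 1` to degree `m`, with its source identified with the dual of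
  -- degree `m` by `K`.
  let mid' := ((D * K).submatrix (en m) (en m)).mulVecLin
  let mid : Module.Dual (MvPolynomial (Fin n) k) (Fin (rank m) → MvPolynomial (Fin n) k)
      →ₗ[MvPolynomial (Fin n) k] (Fin (rank m) → MvPolynomial (Fin n) k) :=
    mid' ∘ₗ (dualCoord _ _).toLinearMap
  have exact_mid : Function.Exact mid (ψ m) := by
    have h1 : Function.Exact mid' (ψ m) := by
      refine exact_submatrix (hinj m) (hinj m) ?_ ?_ ?_ ?_ ?_
      · rw [← Matrix.mul_assoc, hDD, Matrix.zero_mul]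
      · intro a b h
        have := hDKq _ _ h
        rw [hen] at this
        exact hrange m b (by omega)
      · intro a b h
        have := hDKq _ _ h
        rw [hen] at this
        exact hrange m a (by omega)
      · intro a b h
        have := hDq _ _ h
        rw [hen] at this
        exact hrange (m - 1) a (by omega)
      · intro z hz hz0
        have h2 : aug z = 0 := by
          rw [aug_eq]
          refine Finset.sum_eq_zero fun t _ => ?_
          have : z (en 0 t) = 0 := by
            by_contra h
            have h3 := hrange' m _ (hz0 _ h)
            rw [hen] at h3
            omega
          rw [this, zero_smul]
        obtain ⟨y, hy⟩ := hex z hz h2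
        refine ⟨J *ᵥ y, ?_⟩
        rw [Matrix.mulVec_mulVec, Matrix.mul_assoc, hKJ, Matrix.mul_one, hy]
    intro y
    rw [h1 y]
    constructor
    · rintro ⟨x, rfl⟩
      exact ⟨(dualCoord _ _).symm x, by simp [mid]⟩
    · rintro ⟨x, rfl⟩
      exact ⟨dualCoord _ _ x, rfl⟩
  have exact_mid_dual : Function.Exact (ψ m).dualMap mid := by
    have h1 : Function.Exact (Dᵀ.submatrix (en m) (en (m - 1))).mulVecLin mid' := by
      refine exact_submatrix (hinj _) (hinj m) ?_ ?_ ?_ ?_ ?_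
      · rw [Matrix.mul_assoc, hDt, ← Matrix.mul_assoc K, ← Matrix.mul_assoc K, hKJ,
          Matrix.one_mul, ← Matrix.mul_assoc, hDD, Matrix.zero_mul]
      · intro a b h
        have := hDq _ _ h
        rw [hen] at this
        exact hrange (m - 1) b (by omega)
      · intro a b h
        have := hDq _ _ h
        rw [hen] at this
        exact hrange m a (by omega)
      · intro a b h
        have := hDKq _ _ h
        rw [hen] at this
        exact hrange m a (by omega)
      · intro z hz hz0
        refine hexK z (by rwa [Matrix.mulVec_mulVec]) fun a ha => ?_
        rw [hrange' m a (hz0 a ha)]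
        omega
    intro φ
    change mid' (dualCoord _ _ φ) = 0 ↔ _
    rw [h1]
    constructor
    · rintro ⟨x, hx⟩
      refine ⟨(dualCoord _ _).symm x, (dualCoord _ _).injective ?_⟩
      rw [dualCoord_dualMap, LinearEquiv.apply_symm_apply]
      exact hx
    · rintro ⟨χ, rfl⟩
      exact ⟨dualCoord _ _ χ, (dualCoord_dualMap (D.submatrix (en (m - 1)) (en m)) χ).symm⟩
  have exact_left : ∀ i, 1 ≤ i → i < m → Function.Exact (ψ (i + 1)) (ψ i) := by
    intro i hi him
    refine exact_submatrix (hinj _) (hinj i) hDD ?_ ?_ ?_ ?_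
    · intro a b h
      have := hDq _ _ h
      rw [hen] at this
      exact hrange (i + 1) b (by push_cast; omega)
    · intro a b h
      have := hDq _ _ h
      rw [hen] at this
      exact hrange i a (by push_cast at this; omega)
    · intro a b h
      have := hDq _ _ h
      rw [hen] at this
      exact hrange (i - 1) a (by omega)
    · intro z hz hz0
      refine hex z hz ?_
      rw [aug_eq]
      refine Finset.sum_eq_zero fun t _ => ?_
      have : z (en 0 t) = 0 := by
        by_contra h
        have h3 := hrange' i _ (hz0 _ h)
        rw [hen] at h3
        omega
      rw [this, zero_smul]
  have exact_right : ∀ i, 1 ≤ i → i < m →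
      Function.Exact (ψ i).dualMap (ψ (i + 1)).dualMap := by
    intro i hi him
    have h1 : Function.Exact (Dᵀ.submatrix (en i) (en (i - 1))).mulVecLin
        (Dᵀ.submatrix (en (i + 1)) (en i)).mulVecLin := by
      refine exact_submatrix (hinj _) (hinj i) hDtDt ?_ ?_ ?_ ?_
      · intro a b h
        have := hDq _ _ h
        rw [hen] at this
        exact hrange (i - 1) b (by omega)
      · intro a b h
        have := hDq _ _ h
        rw [hen] at this
        exact hrange i a (by omega)
      · intro a b h
        have := hDq _ _ h
        rw [hen] at this
        exact hrange (i + 1) a (by push_cast; omega)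
      · intro z hz hz0
        refine hexDt z hz fun a ha => ?_
        rw [hrange' i a (hz0 a ha)]
        omega
    intro φ
    rw [← (dualCoord _ _).map_eq_zero_iff, dualCoord_dualMap]
    refine (h1 (dualCoord _ _ φ)).trans ?_
    constructor
    · rintro ⟨x, hx⟩
      refine ⟨(dualCoord _ _).symm x, (dualCoord _ _).injective ?_⟩
      rw [dualCoord_dualMap, LinearEquiv.apply_symm_apply]
      exact hx
    · rintro ⟨χ, rfl⟩
      exact ⟨dualCoord _ _ χ, (dualCoord_dualMap (D.submatrix (en (i - 1)) (en i)) χ).symm⟩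
  have exact_zero : Function.Exact (ψ 1) aug' := by
    intro v
    have hv : Function.extend (en 0) v 0 ∘ en 0 = v := funext fun t => (hinj 0).extend_apply _ _ _
    have hrow : ∀ a b, D (en 0 a) b ≠ 0 → b ∈ Set.range (en 1) := by
      intro a b h
      have := hDq _ _ h
      rw [hen] at this
      exact hrange 1 b (by push_cast at this ⊢; omega)
    constructor
    · intro h
      rw [← hv, haug'] at h
      have hD : D *ᵥ Function.extend (en 0) v 0 = 0 := by
        funext a
        refine Finset.sum_eq_zero fun b _ => ?_
        by_contra h0
        have h2 := hDq a b (left_ne_zero_of_mul h0)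
        have h3 : b ∈ Set.range (en 0) := by
          by_contra h4
          exact right_ne_zero_of_mul h0
            (by rw [Function.extend_apply' _ _ _ (by simpa using h4), Pi.zero_apply])
        have h5 := hrange' 0 b h3
        have h6 := hq a
        push_cast at h5
        omega
      obtain ⟨y, hy⟩ := hex _ hD h
      refine ⟨y ∘ en 1, ?_⟩
      refine (submatrix_mulVec_comp D (hinj 1) hrow y).trans ?_
      rw [hy]
      exact hv
    · rintro ⟨x, rfl⟩
      have h1 : ψ 1 x = (D *ᵥ Function.extend (en 1) x 0) ∘ en 0 :=
        funext fun t => submatrix_mulVec_eq_extend D (hinj 1) (en 0) x t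
      rw [h1, haug', haugD]
  have injective_last : Function.Injective (ψ 1).dualMap := by
    rw [injective_iff_map_eq_zero]
    intro φ hφ
    rw [← (dualCoord _ _).map_eq_zero_iff, dualCoord_dualMap] at hφ
    rw [← (dualCoord _ _).map_eq_zero_iff]
    have h1 : Dᵀ *ᵥ Function.extend (en 0) (dualCoord _ _ φ) 0 = 0 := by
      refine mulVec_extend_eq_zero Dᵀ (hinj 0) (v := en 1) (fun a b h => ?_) hφ
      have := hDq _ _ h
      rw [hen] at this
      exact hrange 1 a (by push_cast at this ⊢; omega)
    -- A cocycle in degree 0 is a coboundary, but it would come from degree `-1`, where there is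
    -- nothing.
    obtain ⟨y, hy⟩ := hexDt _ h1 fun a ha => by
      have h3 : a ∈ Set.range (en 0) := by
        by_contra h4
        exact ha (by rw [Function.extend_apply' _ _ _ (by simpa using h4), Pi.zero_apply])
      rw [hrange' 0 a h3]
      push_cast
      omega
    funext t
    rw [← (hinj 0).extend_apply (dualCoord _ _ φ) 0 t, ← hy]
    refine Finset.sum_eq_zero fun b _ => ?_
    by_contra h0
    have h2 := hDq b _ (left_ne_zero_of_mul h0)
    have h6 := hq b
    rw [hen] at h2
    push_cast at h2
    omega
  refine ⟨⟨rank, fun i t => e (en i t), aug', ψ, mid, ?_, ?_, ?_, ?_, exact_zero, exact_left,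
    exact_mid, exact_mid_dual, exact_right, injective_last⟩, ⟨?_, ?_, ?_⟩, ?_⟩
  · intro j v hv
    change ∑ t, v t • aug (Pi.single (en 0 t) 1) ∈ 𝓜 j
    refine Submodule.sum_mem _ fun t _ => ?_
    have := SetLike.GradedSMul.smul_mem (A := weightedHomogeneousSubmodule k d) (B := 𝓜)
      (hv t) (haug (en 0 t))
    rwa [vadd_eq_add, sub_add_cancel] at this
  · intro i _ _
    exact isHomogeneousMap_mulVecLin fun a b => hDe _ _
  · intro j φ hφ t
    change ∑ u, (D * K) (en m t) (en m u) * dualCoord _ _ φ u ∈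
      weightedHomogeneousSubmodule k d (j - e (en m t))
    refine Submodule.sum_mem _ fun u _ => ?_
    have h1 : dualCoord _ _ φ u ∈ weightedHomogeneousSubmodule k d
        (e (en m u) + j + (-(∑ l, d l) - s)) := by
      rw [dualCoord_apply]
      refine hφ _ _ fun t' => ?_
      rcases eq_or_ne t' u with rfl | h
      · rw [Pi.single_eq_same, sub_self]
        exact isWeightedHomogeneous_one _ _
      · rw [Pi.single_eq_of_ne h]
        exact Submodule.zero_mem _
    have h2 := (hDKe (en m t) (en m u)).mul h1
    rwa [show ∑ l, d l + s - e (en m u) - e (en m t) + (e (en m u) + j + (-(∑ l, d l) - s)) =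
      j - e (en m t) by abel] at h2
  · intro x
    obtain ⟨z, rfl⟩ := haug_surj x
    exact ⟨z ∘ en 0, haug' z⟩
  · intro i _ _
    exact isMinimalMap_mulVecLin fun a b => hD0 _ _
  · refine isMinimalMap_of_forall_repr (Pi.basisFun _ _) _ fun φ a => ?_
    simp [mid, mid', Matrix.mulVec, dotProduct, hDK0]
  · intro i _ _
    exact isMinimalMap_dualMap_mulVecLin fun a b => hD0 _ _
  · intro b
    have hsymm : ∀ φ χ : Module.Dual (MvPolynomial (Fin n) k)
        (Fin (rank m) → MvPolynomial (Fin n) k), φ (mid χ) = σ • χ (mid φ) := by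
      intro φ χ
      have h1 : ((D * K).submatrix (en m) (en m))ᵀ = σ • (D * K).submatrix (en m) (en m) := by
        rw [transpose_submatrix, hDKt]
        rfl
      rw [dual_apply_eq_dotProduct φ, dual_apply_eq_dotProduct χ]
      change dualCoord _ _ φ ⬝ᵥ ((D * K).submatrix (en m) (en m) *ᵥ dualCoord _ _ χ) =
        σ • (dualCoord _ _ χ ⬝ᵥ ((D * K).submatrix (en m) (en m) *ᵥ dualCoord _ _ φ))
      rw [Matrix.dotProduct_mulVec, ← Matrix.mulVec_transpose, h1, Matrix.smul_mulVec,
        smul_dotProduct, dotProduct_comm]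
    exact transpose_toMatrix_dualBasis b mid hsymm

end Assembly
-- Graded vector spaces with a Gorenstein form
section GradedModule

variable {k M : Type*} [Field k] [AddCommGroup M] [Module k M] {𝓜 : ℤ → Submodule k M}

lemma exists_homogeneous_basis [DirectSum.Decomposition 𝓜] [Module.Finite k M] :
    ∃ (N : ℕ) (b : Module.Basis (Fin N) k M) (e : Fin N → ℤ),
      (∀ a, b a ∈ 𝓜 (e a)) ∧ ∀ (j : ℤ), ∀ x ∈ 𝓜 j, ∀ a, b.repr x a ≠ 0 → e a = j := by
  classical
  have hint := DirectSum.Decomposition.isInternal 𝓜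
  let v := fun j => Module.Basis.ofVectorSpace k (𝓜 j)
  let b := hint.collectedBasis v
  have := Module.Finite.finite_basis b
  have := Fintype.ofFinite (Σ j, Module.Basis.ofVectorSpaceIndex k (𝓜 j))
  let u := Fintype.equivFin (Σ j, Module.Basis.ofVectorSpaceIndex k (𝓜 j))
  refine ⟨_, b.reindex u, fun a => (u.symm a).1, fun a => ?_, fun j x hx a h => ?_⟩
  · rw [Module.Basis.reindex_apply]
    exact hint.collectedBasis_mem v _
  · rw [Module.Basis.repr_reindex_apply] at h
    by_contra hne
    exact h (hint.collectedBasis_repr_of_mem_ne v (fun h' => hne h'.symm) hx)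

/-- The shift of a graded Gorenstein module is the sum of the extremal degrees. -/
lemma IsGorenstein.shift_eq {R : Type*} [CommRing R] [Module R M] [DirectSum.Decomposition 𝓜]
    {ε : ℤˣ} {s : ℤ} (hG : IsGorenstein R 𝓜 ε s) {a b : ℤ} (ha : IsLeast {j | 𝓜 j ≠ ⊥} a)
    (hb : IsGreatest {j | 𝓜 j ≠ ⊥} b) : s = a + b := by
  classical
  obtain ⟨τ, -, hτ, -⟩ := hG
  -- A functional in the image of degree `j` sees only degree `s - j`, and `τ` is injective. Thus
  -- the set of degrees of `M` is symmetric under `j ↦ s - j`.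
  have key : ∀ j, 𝓜 j ≠ ⊥ → 𝓜 (s - j) ≠ ⊥ := by
    intro j hj hbot
    obtain ⟨x, hx, hx0⟩ := Submodule.exists_mem_ne_zero_of_ne_bot hj
    refine hx0 (τ.map_eq_zero_iff.mp (LinearMap.ext fun y => ?_))
    rw [← DirectSum.sum_support_decompose 𝓜 y, map_sum]
    refine Finset.sum_eq_zero fun i _ => ?_
    by_cases hi : i + j + -s = 0
    · have h1 : i = s - j := by omega
      have h2 : ((DirectSum.decompose 𝓜 y i : 𝓜 i) : M) = 0 := by
        have h3 : 𝓜 i = ⊥ := by rw [h1, hbot]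
        exact (Submodule.eq_bot_iff _).mp h3 _ (Subtype.property _)
      rw [h2, map_zero]
    · exact hτ j x hx i hi _ (Subtype.property _)
  have h1 := ha.2 (key b hb.1)
  have h2 := hb.2 (key a ha.1)
  omega

/-- Up to sign, `τ` factors as the evaluation into the bidual followed by the isomorphism dual to
`τ`. So the evaluation is bijective, and a reflexive vector space is finite-dimensional. -/
lemma IsGorenstein.finite {R : Type*} [CommRing R] [Module R M] {ε : ℤˣ} {s : ℤ}
    (hG : IsGorenstein R 𝓜 ε s) : Module.Finite k M := by
  obtain ⟨τ, -, -, hτ⟩ := hG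
  have h1 : ∀ x, τ.dualMap (Module.Dual.eval k M x) = (ε : ℤ) • τ x := LinearMap.congr_fun hτ
  have h2 : Function.Bijective (Module.Dual.eval k M) := by
    constructor
    · intro x y hxy
      refine τ.injective ?_
      have h3 : (ε : ℤ) • τ x = (ε : ℤ) • τ y := by rw [← h1, ← h1, hxy]
      rcases Int.units_eq_one_or ε with h | h <;> simpa [h] using h3
    · intro φ
      refine ⟨(ε : ℤ) • τ.symm (τ.dualMap φ), τ.dualMap.injective ?_⟩
      rw [h1, map_zsmul, smul_smul, LinearEquiv.apply_symm_apply, ← Units.val_mul,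
        Int.units_mul_self, Units.val_one, one_smul]
  have : Module.IsReflexive k M := ⟨h2⟩
  infer_instance

end GradedModule

/-! ### The bigraded Koszul complex and its augmentation -/

section GradedKoszul

variable {k : Type*} [Field k] {n : ℕ} {d : Fin n → ℤ} {α : Type*}

/-- The homological and the internal degree of a basis element of the Koszul complex. -/
def koszulDegree (d : Fin n → ℤ) (e : α → ℤ) (p : α × Finset (Fin n)) : ℤ × ℤ :=
  (p.2.card, e p.1 + ∑ l ∈ p.2, d l)

/-- Variables have homological degree 0, so homogeneity in the first coordinate says that an entry
vanishes unless the homological degrees match. One bigraded statement thus records both the block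
structure and the internal degrees. -/
lemma isWeightedHomogeneous_prod_iff {p : MvPolynomial (Fin n) k} {g : ℤ × ℤ} :
    IsWeightedHomogeneous (fun l => ((0 : ℤ), d l)) p g ↔
      (p ≠ 0 → g.1 = 0) ∧ IsWeightedHomogeneous d p g.2 := by
  have hw : ∀ c : Fin n →₀ ℕ,
      Finsupp.weight (fun l => ((0 : ℤ), d l)) c = (0, Finsupp.weight d c) := by
    intro c
    simp [Finsupp.weight_apply, Finsupp.sum, Prod.ext_iff, Prod.fst_sum, Prod.snd_sum]
  constructor
  · intro h
    refine ⟨fun hp => ?_, fun c hc => ?_⟩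
    · obtain ⟨c, hc⟩ := MvPolynomial.ne_zero_iff.mp hp
      rw [← h hc, hw]
    · rw [← h hc, hw]
  · rintro ⟨h1, h2⟩ c hc
    have hp : p ≠ 0 := by
      rintro rfl
      exact hc (coeff_zero c)
    rw [hw, h2 hc, ← h1 hp]

lemma isHomog_koszulMatrix [Fintype α] [DecidableEq α] {e : α → ℤ} {x : Fin n → Matrix α α k}
    (hx : ∀ l a a', x l a a' ≠ 0 → e a = d l + e a') :
    IsHomog (fun l => ((0 : ℤ), d l)) (koszulDegree d e) (koszulDegree d e) (-(1, 0))
      (koszulMatrix (diagonalMatrix x)) := by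
  rintro ⟨a, S⟩ ⟨a', T⟩
  rw [koszulMatrix, Matrix.sum_apply]
  refine IsWeightedHomogeneous.sum _ _ _ fun l _ => ?_
  rw [kroneckerMap_apply, Matrix.map_apply, contraction, Matrix.of_apply]
  by_cases h : l ∉ S ∧ T = insert l S
  · obtain ⟨hl, rfl⟩ := h
    have hdeg : koszulDegree d e (a', insert l S) + -(1, 0) - koszulDegree d e (a, S) =
        (0, d l + e a' - e a) := by
      ext
      · simp [koszulDegree, Finset.card_insert_of_notMem hl]
      · simp only [koszulDegree, Finset.sum_insert hl, Prod.snd_add, Prod.snd_sub, Prod.snd_neg]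
        ring
    rw [if_pos ⟨hl, rfl⟩, hdeg, isWeightedHomogeneous_prod_iff, eq_intCast,
      ← map_intCast (C : k →+* MvPolynomial (Fin n) k), mul_comm]
    refine ⟨fun _ => rfl, IsWeightedHomogeneous.C_mul ?_ _⟩
    refine IsWeightedHomogeneous.sub ?_ ?_
    · rw [Matrix.smul_apply, Matrix.one_apply]
      split_ifs with h
      · obtain rfl : a = a' := h
        rw [add_sub_cancel_right, smul_eq_mul, mul_one]
        exact isWeightedHomogeneous_X _ _ _
      · rw [smul_zero]
        exact isWeightedHomogeneous_zero _ _ _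
    · rw [Matrix.map_apply]
      by_cases h0 : x l a a' = 0
      · rw [h0, map_zero]
        exact isWeightedHomogeneous_zero _ _ _
      · rw [hx l a a' h0, sub_self]
        exact isWeightedHomogeneous_C _ _
  · rw [if_neg h, map_zero, mul_zero]
    exact isWeightedHomogeneous_zero _ _ _

/-- Complementary sets have sizes adding up to `n` and weights adding up to `∑ l, d l`; together
with the shift `s` of the form on `M`, this produces the twist by `-d - s` in the duality. -/
lemma isHomogConst_koszulForm {e : α → ℤ} {T : Matrix α α k} {s : ℤ}
    (hT : ∀ a a', T a a' ≠ 0 → e a + e a' = s) :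
    IsHomogConst (fun p => ((n : ℤ), ∑ l, d l + s) - koszulDegree d e p) (koszulDegree d e) 0
      (kroneckerMap (· * ·) T ((koszulForm n).map (Int.castRingHom k))) := by
  rintro ⟨a, S⟩ ⟨a', S'⟩ h
  rw [kroneckerMap_apply, Matrix.map_apply, koszulForm, Matrix.of_apply] at h
  have h1 := hT a a' (left_ne_zero_of_mul h)
  have h2 : S' = Sᶜ := by
    by_contra h2
    rw [if_neg h2, map_zero, mul_zero] at h
    exact h rfl
  have h3 := Finset.card_add_card_compl S
  rw [Fintype.card_fin] at h3
  have h4 := Finset.sum_add_sum_compl S d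
  ext
  · simp only [koszulDegree, h2, Prod.fst_add, Prod.fst_sub, Prod.fst_zero]
    omega
  · simp only [koszulDegree, h2, Prod.snd_add, Prod.snd_sub, Prod.snd_zero]
    omega

variable {M : Type*} [AddCommGroup M] [Module k M] [Module (MvPolynomial (Fin n) k) M]
  [Fintype α] (b : Module.Basis α k M)

/-- The augmentation of the Koszul complex. -/
noncomputable def koszulAug :
    (α × Finset (Fin n) → MvPolynomial (Fin n) k) →ₗ[MvPolynomial (Fin n) k] M :=
  baseAug b ∘ₗ LinearMap.funLeft _ _ fun a => (a, ∅)

lemma koszulAug_apply (z : α × Finset (Fin n) → MvPolynomial (Fin n) k) :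
    koszulAug b z = baseAug b fun a => z (a, ∅) := rfl

lemma koszulAug_surjective [IsScalarTower k (MvPolynomial (Fin n) k) M] :
    Function.Surjective (koszulAug (n := n) b) := by
  intro x
  refine ⟨fun p => C (b.repr x p.1), ?_⟩
  conv_rhs => rw [← b.sum_repr x]
  exact Finset.sum_congr rfl fun a _ => by
    simp only [LinearMap.funLeft_apply]
    rw [← algebraMap_eq, algebraMap_smul]

lemma koszulAug_koszulMatrix [DecidableEq α] [IsScalarTower k (MvPolynomial (Fin n) k) M]
    (z : α × Finset (Fin n) → MvPolynomial (Fin n) k) :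
    koszulAug b (koszulMatrix (diagonalMatrix (varMatrix b)) *ᵥ z) = 0 := by
  have h := koszulMatrix_mulVec k (diagonalMatrix (n := n) (varMatrix b)) (fun S a => z (a, S))
  change koszulAug b (koszulMatrix (diagonalMatrix (varMatrix b)) *ᵥ (fun p => z (p.1, p.2))) = 0
  rw [h, koszulAug_apply]
  have h2 : ∀ y : Finset (Fin n) → α → MvPolynomial (Fin n) k, (fun a => koszulEnd
      (fun l => mulVecEnd k (diagonalMatrix (varMatrix b) l)) y ∅ a) =
      ∑ l, diagonalMatrix (varMatrix b) l *ᵥ y {l} := fun y => by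
    funext a
    simp [koszulEnd_apply, koszulSign, mulVecEnd_apply]
  rw [h2, map_sum]
  exact Finset.sum_eq_zero fun l _ => baseAug_diagonalMatrix b l _

end GradedKoszul

/-! ### The Gorenstein form in coordinates -/

section FormMatrix

variable {k : Type*} [Field k] {n : ℕ} {d : Fin n → ℤ} {α : Type*}
  {M : Type*} [AddCommGroup M] [Module k M] [Module (MvPolynomial (Fin n) k) M]
  {𝓜 : ℤ → Submodule k M} (b : Module.Basis α k M) (τ : M ≃ₗ[k] Module.Dual k M)

/-- The matrix of the bilinear form `τ`. -/
noncomputable def formMatrix : Matrix α α k := Matrix.of fun a a' => τ (b a) (b a')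

lemma exists_formMatrix_mul_eq_one [Fintype α] [DecidableEq α] : ∃ T', formMatrix b τ * T' = 1 := by
  refine ⟨(LinearMap.toMatrix b.dualBasis b τ.symm.toLinearMap)ᵀ, ?_⟩
  have h : formMatrix b τ = (LinearMap.toMatrix b b.dualBasis τ.toLinearMap)ᵀ := by
    ext a a'
    rw [Matrix.transpose_apply, LinearMap.toMatrix_apply, Module.Basis.dualBasis_repr]
    rfl
  rw [h, ← transpose_mul, ← LinearMap.toMatrix_comp, LinearEquiv.comp_coe]
  simp

lemma transpose_formMatrix {ε : ℤˣ}
    (hτ : τ.toLinearMap.dualMap ∘ₗ Module.Dual.eval k M = (ε : ℤ) • τ.toLinearMap) :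
    (formMatrix b τ)ᵀ = (ε : ℤ) • formMatrix b τ := by
  ext a a'
  exact LinearMap.congr_fun (LinearMap.congr_fun hτ (b a)) (b a')

lemma transpose_varMatrix_mul_formMatrix [Fintype α]
    (hτ : ∀ (r : MvPolynomial (Fin n) k) (x y : M), τ (r • x) y = τ x (r • y)) (l : Fin n) :
    (varMatrix b l)ᵀ * formMatrix b τ = formMatrix b τ * varMatrix b l := by
  ext a a'
  have h := hτ (X l) (b a) (b a')
  rw [← sum_varMatrix_smul b, ← sum_varMatrix_smul b, map_sum, map_sum,
    LinearMap.sum_apply] at h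
  simp only [map_smul, LinearMap.smul_apply, smul_eq_mul] at h
  rw [Matrix.mul_apply, Matrix.mul_apply]
  refine h.trans (Finset.sum_congr rfl fun c _ => mul_comm _ _)

lemma transpose_diagonalMatrix_mul [Fintype α] [DecidableEq α] {x : Fin n → Matrix α α k}
    {T : Matrix α α k} {l : Fin n}
    (h : (x l)ᵀ * T = T * x l) :
    (diagonalMatrix x l)ᵀ * T.map C = T.map C * diagonalMatrix x l := by
  rw [diagonalMatrix, transpose_sub, transpose_smul, transpose_one, sub_mul, mul_sub,
    smul_mul_assoc, mul_smul_comm, one_mul, mul_one, ← Matrix.transpose_map, ← Matrix.map_mul, h,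
    Matrix.map_mul]

end FormMatrix

end GorensteinFiniteLength

/-! ### The main theorem -/

open GorensteinFiniteLength Matrix in
theorem mainTheorem4 {k : Type*} [Field k] (hk : ringChar k ≠ 2)
    {n m : ℕ} (hn : 3 ≤ n) (hm : n = 2 * m + 1)
    (d : Fin n → ℤ) (hd : ∀ l, 0 < d l)
    {M : Type*} [AddCommGroup M] [Module k M] [Module (MvPolynomial (Fin n) k) M]
    [IsScalarTower k (MvPolynomial (Fin n) k) M]
    (𝓜 : ℤ → Submodule k M) [DirectSum.Decomposition 𝓜]
    [SetLike.GradedSMul (MvPolynomial.weightedHomogeneousSubmodule k d) 𝓜]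
    (hfin : IsFiniteLength (MvPolynomial (Fin n) k) M)
    (ε : ℤˣ) (s : ℤ)
    (hG : GorensteinFiniteLength.IsGorenstein (MvPolynomial (Fin n) k) 𝓜 ε s) :
    (∀ a b : ℤ, IsLeast {j | 𝓜 j ≠ ⊥} a → IsGreatest {j | 𝓜 j ≠ ⊥} b → s = a + b) ∧
    ∃ F : GorensteinFiniteLength.SelfdualResolution d 𝓜 m s,
      F.IsMinimal ∧
      ∀ b : Module.Basis (Fin (F.rank m)) (MvPolynomial (Fin n) k)
          (Fin (F.rank m) → MvPolynomial (Fin n) k),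
        (LinearMap.toMatrix b.dualBasis b F.mid).transpose =
          (((-1) ^ m * ε : ℤˣ) : ℤ) • LinearMap.toMatrix b.dualBasis b F.mid := by
  refine ⟨fun _ _ ha hb => hG.shift_eq ha hb, ?_⟩
  have := hG.finite
  obtain ⟨N, b, e, hb, hrepr⟩ := exists_homogeneous_basis (𝓜 := 𝓜)
  obtain ⟨τ, hτR, hτ, hτε⟩ := hG
  have h2 : (2 : k) ≠ 0 := Ring.two_ne_zero hk
  set σ : ℤ := (((-1) ^ m * ε : ℤˣ) : ℤ) with hσ_def
  have hσ : σ * σ = 1 := by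
    rw [hσ_def, ← Units.val_mul, Int.units_mul_self, Units.val_one]
  set D := koszulMatrix (diagonalMatrix (n := n) (varMatrix b)) with hD_def
  have hvar : ∀ l a a', varMatrix b l a a' ≠ 0 → e a = d l + e a' := fun l a a' h =>
    hrepr _ _ (SetLike.GradedSMul.smul_mem (A := weightedHomogeneousSubmodule k d) (B := 𝓜)
      (isWeightedHomogeneous_X k d l) (hb a')) a h
  -- Each variable strictly raises the degree of the finitely many basis elements.
  have hnil : ∀ l : Fin n, IsNilpotent (varMatrix b l) := fun l =>
    isNilpotent_of_lt (fun a => -e a) fun a a' h => by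
      have h3 := hvar l a a' h
      have h4 := hd l
      omega
  have hDhom : IsHomog _ _ _ _ D := isHomog_koszulMatrix hvar
  have hDD : D * D = 0 := koszulMatrix_mul_self _ (diagonalMatrix_comm (varMatrix_comm b))
  set J := kroneckerMap (· * ·) (formMatrix b τ) ((koszulForm n).map (Int.castRingHom k))
    with hJ_def
  have hJhom : IsHomogConst (fun p => ((n : ℤ), ∑ l, d l + s) - koszulDegree d e p)
      (koszulDegree d e) 0 J := by
    refine isHomogConst_koszulForm fun a a' h => ?_
    by_contra hne
    exact h (hτ (e a) (b a) (hb a) (e a') (by omega) (b a') (hb a'))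
  obtain ⟨T', hT'⟩ := exists_formMatrix_mul_eq_one b τ
  have hJJ' : J * kroneckerMap (· * ·) T' ((koszulForm n)ᵀ.map (Int.castRingHom k)) = 1 := by
    rw [hJ_def, ← mul_kronecker_mul, hT', ← Matrix.map_mul, koszulForm_mul_transpose,
      Matrix.map_one _ (map_zero _) (map_one _)]
    exact one_kronecker_one
  have hJt : Jᵀ = σ • J := by
    rw [hJ_def, ← kroneckerMap_transpose, transpose_formMatrix b τ hτε, ← Matrix.transpose_map,
      transpose_koszulForm hm]
    ext p p'
    rcases Int.units_eq_one_or ε with h | h <;>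
      rcases neg_one_pow_eq_or ℤ m with h' | h' <;> simp [kroneckerMap_apply, hσ_def, h, h']
  have hDJ : Dᵀ * J.map C = J.map C * D := by
    have h3 : J.map (C : k →+* MvPolynomial (Fin n) k) = kroneckerMap (· * ·)
        ((formMatrix b τ).map C) ((koszulForm n).map (Int.castRingHom _)) := by
      ext1 p p'
      simp [hJ_def, kroneckerMap_apply]
    rw [h3]
    exact transpose_koszulMatrix_mul _ _ fun l =>
      transpose_diagonalMatrix_mul (transpose_varMatrix_mul_formMatrix b τ hτR l)
  -- The projection to the internal degree ignores the homological shift `(1, 0)` and is positive on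
  -- the variables.
  obtain ⟨red⟩ := exists_minimalReduction h2 (ω := (1, 0)) (AddMonoidHom.snd ℤ ℤ) rfl
    (fun l => hd l) hDhom hDD hJJ' hJhom hσ hJt hDJ
  have hD₁ := fun a a' => isWeightedHomogeneous_prod_iff.mp (red.D₁_homog a a')
  have hK₁ := fun a a' => isWeightedHomogeneous_prod_iff.mp (red.K₁_homog a a')
  have hI := fun p a => isWeightedHomogeneous_prod_iff.mp (red.I_homog p a)
  -- The homotopy raises the homological degree by one, so its image has no component in degree 0,
  -- the only one seen by the augmentation.
  have hH : ∀ v, koszulAug b (red.H *ᵥ v) = 0 := by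
    intro v
    have h3 : (fun a => (red.H *ᵥ v) (a, ∅)) = 0 := by
      funext a
      refine Finset.sum_eq_zero fun p _ => mul_eq_zero_of_left ?_ _
      by_contra h4
      have h5 := (isWeightedHomogeneous_prod_iff.mp (red.H_homog (a, ∅) p)).1 h4
      simp [koszulDegree] at h5
      omega
    rw [koszulAug_apply, h3, map_zero]
  have haug : ∀ a : red.index, (koszulAug b ∘ₗ red.I.mulVecLin) (Pi.single a 1) =
      ∑ a', red.I (a', ∅) a • b a' := by
    intro a
    rw [LinearMap.comp_apply, Matrix.mulVecLin_apply, Matrix.mulVec_single_one]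
    rfl
  refine exists_selfdualResolution (by omega) (q := fun a : red.index => (koszulDegree d e a).1)
    (e := fun a : red.index => (koszulDegree d e a).2) (D := red.D₁) (J := red.J₁) (K := red.K₁)
    (aug := koszulAug b ∘ₗ red.I.mulVecLin) ?_ ?_ ?_ ?_ ?_ red.D₁_minimal red.D₁_selfadjoint
    red.J₁_mul_K₁ red.K₁_transpose ?_ ?_ ?_ ?_ ?_ ?_
  · exact fun a => Nat.cast_nonneg _
  · intro a a' h
    have h3 := (hD₁ a a').1 h
    simp only [Prod.fst_sub, Prod.fst_add, Prod.fst_neg] at h3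
    omega
  · intro a a'
    have h3 := (hD₁ a a').2
    simpa only [Prod.snd_sub, Prod.snd_add, Prod.snd_neg, neg_zero, add_zero] using h3
  · intro a a' h
    have h3 := (hK₁ a a').1 h
    simp only [Prod.fst_sub, Prod.fst_add, Prod.fst_zero] at h3
    omega
  · intro a a'
    have h3 := (hK₁ a a').2
    simpa only [Prod.snd_sub, Prod.snd_add, Prod.snd_zero, add_zero] using h3
  · calc red.D₁ * red.D₁ = red.D₁ * (red.P * red.I) * red.D₁ := by
          rw [red.P_mul_I, Matrix.mul_one]
      _ = red.P * (D * D) * red.I := by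
          simp only [Matrix.mul_assoc, ← red.D_mul_I]
          rw [← Matrix.mul_assoc, ← red.P_mul_D]
          simp only [Matrix.mul_assoc]
      _ = 0 := by rw [hDD]; simp
  · intro a ha
    rw [haug]
    refine Finset.sum_eq_zero fun a' _ => ?_
    have h3 : red.I (a', ∅) a = 0 := by
      by_contra h4
      have h5 := (hI (a', ∅) a).1 h4
      simp only [koszulDegree, Prod.fst_sub, Prod.fst_add, Prod.fst_zero, Finset.card_empty] at h5
      exact ha (by simpa [koszulDegree] using h5)
    rw [h3, zero_smul]
  · intro a
    rw [haug]
    refine Submodule.sum_mem _ fun a' _ => ?_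
    have h3 := SetLike.GradedSMul.smul_mem (A := weightedHomogeneousSubmodule k d) (B := 𝓜)
      (hI (a', ∅) a).2 (hb a')
    simpa [koszulDegree] using h3
  · intro y
    rw [LinearMap.comp_apply, Matrix.mulVecLin_apply, Matrix.mulVec_mulVec, ← red.D_mul_I,
      ← Matrix.mulVec_mulVec, koszulAug_koszulMatrix]
  · intro x
    obtain ⟨z, rfl⟩ := koszulAug_surjective (n := n) b x
    refine ⟨red.P *ᵥ z, ?_⟩
    rw [LinearMap.comp_apply, Matrix.mulVecLin_apply, Matrix.mulVec_mulVec, red.I_mul_P,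
      Matrix.sub_mulVec, Matrix.sub_mulVec, ← Matrix.mulVec_mulVec, ← Matrix.mulVec_mulVec, map_sub,
      map_sub, hH, koszulAug_koszulMatrix, Matrix.one_mulVec, sub_zero, sub_zero]
  · intro z hz hz0
    have h3 : D *ᵥ (red.I *ᵥ z) = 0 := by
      rw [Matrix.mulVec_mulVec, red.D_mul_I, ← Matrix.mulVec_mulVec, hz, Matrix.mulVec_zero]
    -- Exactness is inherited through the chain maps: a boundary `D *ᵥ y` of `I *ᵥ z` is projected
    -- back by `P`, using `P * I = 1`.
    obtain ⟨y, hy⟩ := exists_koszulMatrix_mulVec_eq b hnil h3 hz0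
    refine ⟨red.P *ᵥ y, ?_⟩
    rw [Matrix.mulVec_mulVec, ← red.P_mul_D, ← Matrix.mulVec_mulVec, hy, Matrix.mulVec_mulVec,
      red.P_mul_I, Matrix.one_mulVec]
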